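/- All graphs are finite and simple. A *module* of a graph $G$ is a set $M\subseteq V(G)$ such that every vertex outside $M$ is adjacent to all of $M$ or to none of $M$; $G$ is *prime* (for modular decomposition) if each of its modules has at most one element or equals $V(G)$. An *asteroidal triple* consists of three distinct vertices such that each two of them are joined by a path containing no vertex of the closed neighbourhood of the third; $G$ is *AT-free* if it has no asteroidal triple. $G$ is *distance-hereditary* (DH) if distances in every connected induced subgraph of $G$ are equal to distances in $G$. A *graph-labelled tree* is a tree in which every internal node $v$ is labelled by a graph $G_v$ whose vertices are in bijection with the tree-edges at $v$. Its *accessibility graph* has the leaves of the tree as vertices, two leaves being adjacent if and only if, for any two consecutive edges on the tree-path between them, with common node $v$, the corresponding vertices of $G_v$ are adjacent. A *canonical split decomposition* of $G$ is a graph-labelled tree whose accessibility graph is $G$ (up to isomorphism) and such that: every internal node has degree at least $3$ and is labelled by a clique, a star, or a connected graph admitting no split (a *split* being a bipartition $(A,B)$ of the vertex set with $|A|,|B|\ge 2$ whose crossing edges are exactly all the pairs between some $A'\subseteq A$ and some $B'\subseteq B$); no two adjacent nodes are both labelled by cliques; and no tree-edge joins two star-labelled nodes in such a way that it corresponds to the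 centre of one star and to a non-central vertex of the other. A *caterpillar* is a tree with a path such that every vertex is on the path or adjacent to a vertex of the path. Let $G$ be a graph. 1. If $G$ is prime and AT-free, then the tree of every canonical split decomposition of $G$ is a caterpillar. 2. $G$ is both distance-hereditary and AT-free if and only if no induced subgraph of $G$ is isomorphic to one of the following graphs: a hole (a cycle of length at least $5$), the domino (a $6$-cycle with one chord joining two opposite vertices), the house (a $4$-cycle plus a vertex adjacent to exactly two consecutive vertices of it), the gem (a path on $4$ vertices plus a vertex adjacent to all of them), $A_1$ (the claw $K_{1,3}$ with every edge subdivided once), $A_{2,2}$ (a triangle with a pendant vertex attached to each of its vertices), $A_3$ (a $4$-cycle with a pendant vertex attached to each of three of its vertices), $A_{2,3}$ (a path $p_1p_2p_3$ and a vertex $c$ adjacent to $p_1,p_2,p_3$, with a pendant vertex attached to each of $p_1$, $p_3$, $c$). 3. Moreover, these graphs are, up to isomorphism, exactly the minimal forbidden induced subgraphs: $G$ fails to be both distance-hereditary and AT-free while each of its proper induced subgraphs is both, if and only if $G$ is isomorphic to one of the graphs listed in 2. -/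

import Mathlib

open SimpleGraph

/-- A module: no vertex outside `M` distinguishes two elements of `M`. -/
def IsGraphModule {V : Type*} (G : SimpleGraph V) (M : Set V) : Prop :=
  ∀ v, v ∉ M → (∀ m ∈ M, G.Adj v m) ∨ (∀ m ∈ M, ¬ G.Adj v m)

/-- Prime for the modular decomposition: every module has at most one element or is everything. -/
def IsModularPrime {V : Type*} (G : SimpleGraph V) : Prop :=
  ∀ M : Set V, IsGraphModule G M → M.Subsingleton ∨ M = Set.univ

/-- There is a path from `x` to `y` that does not dominate `z`, that is, no vertex of the path
lies in the closed neighbourhood of `z`. -/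
def HasPathMissing {V : Type*} (G : SimpleGraph V) (x y z : V) : Prop :=
  ∃ p : G.Walk x y, p.IsPath ∧ ∀ w ∈ p.support, w ≠ z ∧ ¬ G.Adj z w

/-- Three (distinct) vertices such that each two of them are joined by a path that does not
dominate the third. -/
def IsAsteroidalTriple {V : Type*} (G : SimpleGraph V) (x y z : V) : Prop :=
  x ≠ y ∧ y ≠ z ∧ x ≠ z ∧
    HasPathMissing G x y z ∧ HasPathMissing G y z x ∧ HasPathMissing G x z y

def IsATFree {V : Type*} (G : SimpleGraph V) : Prop :=
  ∀ x y z : V, ¬ IsAsteroidalTriple G x y z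

/-- Distance-hereditary: connected induced subgraphs preserve distances. -/
def IsDistanceHereditary {V : Type*} (G : SimpleGraph V) : Prop :=
  ∀ S : Set V, (G.induce S).Connected →
    ∀ x y : S, (G.induce S).dist x y = G.dist (x : V) (y : V)

/-- A caterpillar: a tree with a path such that every vertex is on the path or adjacent to a
vertex of the path. -/
def IsCaterpillar {N : Type*} (T : SimpleGraph N) : Prop :=
  T.IsTree ∧ ∃ (a b : N) (p : T.Walk a b), p.IsPath ∧
    ∀ w, w ∈ p.support ∨ ∃ x ∈ p.support, T.Adj x w

/-- `A` and its complement form a split: both have at least two elements, and the edges between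
them form a complete bipartite graph between a subset of `A` and a subset of its complement. -/
def IsSplit {V : Type*} (G : SimpleGraph V) (A : Set V) : Prop :=
  A.Nontrivial ∧ Aᶜ.Nontrivial ∧
    ∃ A' B' : Set V, A' ⊆ A ∧ B' ⊆ Aᶜ ∧
      ∀ a ∈ A, ∀ b ∈ Aᶜ, (G.Adj a b ↔ a ∈ A' ∧ b ∈ B')

/-- Prime for the split decomposition: connected and without a split. -/
def IsSplitPrime {V : Type*} (G : SimpleGraph V) : Prop :=
  G.Connected ∧ ∀ A : Set V, ¬ IsSplit G A

def IsCompleteLabel {V : Type*} (G : SimpleGraph V) : Prop :=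
  ∀ x y : V, x ≠ y → G.Adj x y

/-- The graph is a star with centre `c`. -/
def IsStarWithCentre {V : Type*} (G : SimpleGraph V) (c : V) : Prop :=
  ∀ x y : V, G.Adj x y ↔ x ≠ y ∧ (x = c ∨ y = c)

/-- A graph-labelled tree with node set `N`. The tree-edges at `v` correspond to the neighbours of
`v` in the tree, and the marker vertices of the label of `v` are identified with them: the
neighbour `w` of `v` stands for the extremity at `v` of the tree-edge `vw`. The label of a leaf
is the only graph on one vertex and carries no information. -/
structure GraphLabelledTree (N : Type*) where
  tree : SimpleGraph N
  isTree : tree.IsTree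
  label : (v : N) → SimpleGraph (tree.neighborSet v)

namespace GraphLabelledTree

variable {N : Type*} (D : GraphLabelledTree N)

/-- Leaves have degree at most one (degree zero only if the tree has a single vertex). -/
def IsLeaf (v : N) : Prop := (D.tree.neighborSet v).Subsingleton

/-- `u` is `l`-accessible: for all consecutive tree-edges `av`, `vb` on the path from `l` to `u`,
their extremities at `v` are adjacent in the label of `v`. -/
def Accessible (l u : N) : Prop :=
  ∃ p : D.tree.Walk l u, p.IsPath ∧
    ∀ (a v b : N) (ha : D.tree.Adj v a) (hb : D.tree.Adj v b),
      [a, v, b] <:+: p.support → (D.label v).Adj ⟨a, ha⟩ ⟨b, hb⟩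

theorem Accessible.symm {l u : N} (h : D.Accessible l u) : D.Accessible u l := by
  obtain ⟨p, hp, hadj⟩ := h
  refine ⟨p.reverse, hp.reverse, ?_⟩
  intro a v b ha hb hinf
  refine (hadj b v a hb ha ?_).symm
  rw [SimpleGraph.Walk.support_reverse] at hinf
  simpa using List.reverse_infix.mpr hinf

/-- The accessibility graph: vertices are the leaves of the tree, adjacency is accessibility. -/
def accessibilityGraph : SimpleGraph {v : N // D.IsLeaf v} where
  Adj x y := x ≠ y ∧ D.Accessible x y
  symm := ⟨fun _ _ h => ⟨h.1.symm, Accessible.symm D h.2⟩⟩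
  loopless := ⟨fun _ h => h.1 rfl⟩

/-- Reduced graph-labelled trees: every internal node has degree at least three and is labelled by
a complete graph, a star or a graph that is prime for the split decomposition, no two complete
nodes are adjacent, and no tree-edge between two star nodes has the centre of one star and a
non-central vertex of the other star as its extremities. -/
def IsReduced : Prop :=
  (∀ v, ¬ D.IsLeaf v → 3 ≤ (D.tree.neighborSet v).ncard) ∧
  (∀ v, ¬ D.IsLeaf v →
    IsCompleteLabel (D.label v) ∨ (∃ c, IsStarWithCentre (D.label v) c) ∨
      IsSplitPrime (D.label v)) ∧
  (∀ u v, D.tree.Adj u v → ¬ D.IsLeaf u → ¬ D.IsLeaf v →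
    ¬ (IsCompleteLabel (D.label u) ∧ IsCompleteLabel (D.label v))) ∧
  (∀ (u v : N) (huv : D.tree.Adj u v), ¬ D.IsLeaf u → ¬ D.IsLeaf v →
    ∀ c, IsStarWithCentre (D.label u) ⟨v, huv⟩ → IsStarWithCentre (D.label v) c →
      c = ⟨u, huv.symm⟩)

/-- `D` is the canonical split decomposition of `G`: it is reduced and `G` is its accessibility
graph, up to renaming the leaves. -/
def IsCanonicalSplitDecomposition {V : Type*} (G : SimpleGraph V) : Prop :=
  D.IsReduced ∧ Nonempty (G ≃g D.accessibilityGraph)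

end GraphLabelledTree

/-- The graph on `Fin n` whose edges are the listed pairs. -/
def graphOfPairs (n : ℕ) (l : List (Fin n × Fin n)) : SimpleGraph (Fin n) :=
  SimpleGraph.fromRel fun i j => (i, j) ∈ l

/-- A four-cycle and a further vertex adjacent to two consecutive vertices of it. -/
def houseGraph : SimpleGraph (Fin 5) :=
  graphOfPairs 5 [(0, 1), (1, 2), (2, 3), (3, 0), (0, 4), (1, 4)]

/-- A six-cycle with one chord joining two opposite vertices. -/
def dominoGraph : SimpleGraph (Fin 6) :=
  graphOfPairs 6 [(0, 1), (1, 2), (2, 3), (3, 4), (4, 5), (5, 0), (0, 3)]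

/-- A path on four vertices and a further vertex adjacent to all of them. -/
def gemGraph : SimpleGraph (Fin 5) :=
  graphOfPairs 5 [(0, 1), (1, 2), (2, 3), (4, 0), (4, 1), (4, 2), (4, 3)]

/-- `A₁`: the claw with every edge subdivided once. -/
def graphA1 : SimpleGraph (Fin 7) :=
  graphOfPairs 7 [(0, 1), (0, 2), (0, 3), (1, 4), (2, 5), (3, 6)]

/-- `A₂,₂`: a triangle with a pendant vertex at each of its vertices (the net). -/
def graphA22 : SimpleGraph (Fin 6) :=
  graphOfPairs 6 [(0, 1), (1, 2), (2, 0), (0, 3), (1, 4), (2, 5)]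

/-- `A₃`: a four-cycle with a pendant vertex at each of three of its vertices. -/
def graphA3 : SimpleGraph (Fin 7) :=
  graphOfPairs 7 [(0, 1), (1, 2), (2, 3), (3, 0), (0, 4), (1, 5), (2, 6)]

/-- `A₂,₃`: a path `0, 1, 2` and a vertex `3` adjacent to all of it, with a pendant vertex at each
of `0`, `2`, `3`. -/
def graphA23 : SimpleGraph (Fin 7) :=
  graphOfPairs 7 [(0, 1), (1, 2), (3, 0), (3, 1), (3, 2), (0, 4), (2, 5), (3, 6)]

/-- `H` is isomorphic to a hole (a cycle of length at least five), the domino, the house, the gem,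
`A₁`, `A₂,₂`, `A₃` or `A₂,₃`. -/
def IsListedObstruction {W : Type*} (H : SimpleGraph W) : Prop :=
  (∃ n : ℕ, 5 ≤ n ∧ Nonempty (H ≃g SimpleGraph.cycleGraph n)) ∨
  Nonempty (H ≃g dominoGraph) ∨ Nonempty (H ≃g houseGraph) ∨ Nonempty (H ≃g gemGraph) ∨
  Nonempty (H ≃g graphA1) ∨ Nonempty (H ≃g graphA22) ∨ Nonempty (H ≃g graphA3) ∨
  Nonempty (H ≃g graphA23)

/-- The class of graphs that are both distance-hereditary and AT-free. -/
def IsDHATFree {V : Type*} (G : SimpleGraph V) : Prop :=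
  IsDistanceHereditary G ∧ IsATFree G

/-! Distance-heredity is reached through uniform attachments: for each vertex x, all members of N(x)
with a neighbour in a given component of G - N[x] have the same neighbours there. Excluding holes,
house, gem and domino forces this (`IsObstructionFree.hasUniformAttachments`), and it makes
geodesics of connected induced subgraphs geodesic in G (`HasUniformAttachments.dist_eq`).

For AT-freeness, take an asteroidal triple x, y, z with least sum of distances, and attachments a,
b, c of x, y, z towards the other two. An attachment is one step closer to the other two vertices,
so if some x-y path missed c, then x, y, c would be a smaller triple. Three edges among a, b, c give
the net; exactly two give A₃ or A₂,₃; exactly one, say ab, gives the path x, a, b, y missing c; with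
none, all distances are forced to be 4 and a common neighbour of a, b, c completes A₁.

Conversely every listed graph visibly fails one of the two properties, both of which are hereditary.
Since no listed graph embeds properly in another, the list is exactly the set of minimal
obstructions.

For the split tree, a tree in which no node has three non-leaf neighbours is a caterpillar. If a
node v had three, modular primality and reducedness would supply behind each of them a leaf with no
neighbour outside its own branch (`exists_mem_leafSide_diff`). The rest of the graph stays connected
around the closed neighbourhood of such a leaf (`hasPathMissing_of_leafSide`), so the three leaves
form an asteroidal triple. -/

section Basics

/-! ### Paths missing a vertex, and distances under uniform attachments. -/

variable {V : Type*} {G : SimpleGraph V}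

/-- The spanning subgraph of `G` whose edges are the edges of `G` inside `S`. -/
def edgesWithin (G : SimpleGraph V) (S : Set V) : SimpleGraph V where
  Adj a b := G.Adj a b ∧ a ∈ S ∧ b ∈ S
  symm := ⟨fun _ _ h => ⟨h.1.symm, h.2.2, h.2.1⟩⟩
  loopless := ⟨fun _ h => h.1.ne rfl⟩

theorem edgesWithin_mono {S S' : Set V} (h : S ⊆ S') : edgesWithin G S ≤ edgesWithin G S' :=
  fun _ _ hab => ⟨hab.1, h hab.2.1, h hab.2.2⟩

theorem edgesWithin_mono_left {H : SimpleGraph V} (h : H ≤ G) (S : Set V) :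
    edgesWithin H S ≤ edgesWithin G S :=
  fun _ _ hab => ⟨h hab.1, hab.2⟩

theorem edgesWithin_le (S : Set V) : edgesWithin G S ≤ G := fun _ _ hab => hab.1

/-- The complement of the closed neighbourhood of `x`. -/
def farFrom (G : SimpleGraph V) (x : V) : Set V := {w | w ≠ x ∧ ¬ G.Adj x w}

theorem mem_farFrom_comm {x y : V} : y ∈ farFrom G x ↔ x ∈ farFrom G y := by
  simp only [farFrom, Set.mem_ofPred_eq, G.adj_comm x y, ne_comm]

theorem SimpleGraph.Walk.support_subset_of_edgesWithin {S : Set V} {a b : V}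
    (p : (edgesWithin G S).Walk a b) (ha : a ∈ S) : ∀ w ∈ p.support, w ∈ S := by
  induction p with
  | nil => simpa using ha
  | cons h p ih =>
    intro w hw
    rw [Walk.support_cons, List.mem_cons] at hw
    rcases hw with rfl | hw
    · exact ha
    · exact ih h.2.2 w hw

theorem mem_of_reachable_edgesWithin {S : Set V} {a b : V}
    (h : (edgesWithin G S).Reachable a b) (ha : a ∈ S) : b ∈ S := by
  obtain ⟨p⟩ := h
  exact p.support_subset_of_edgesWithin ha b p.end_mem_support

theorem SimpleGraph.Walk.reachable_edgesWithin {S : Set V} {a b : V} (p : G.Walk a b)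
    (h : ∀ w ∈ p.support, w ∈ S) : (edgesWithin G S).Reachable a b := by
  induction p with
  | nil => exact Reachable.refl _
  | cons hadj p ih =>
    simp only [Walk.support_cons, List.mem_cons, forall_eq_or_imp] at h
    have hadj' : (edgesWithin G S).Adj _ _ := ⟨hadj, h.1, h.2 _ p.start_mem_support⟩
    exact hadj'.reachable.trans (ih h.2)

/-- Turns paths into reachability, so that they can be reversed and concatenated. Membership of `x`
is needed because a vertex outside the far set still reaches itself. -/
theorem hasPathMissing_iff {x y z : V} :
    HasPathMissing G x y z ↔ x ∈ farFrom G z ∧ (edgesWithin G (farFrom G z)).Reachable x y := by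
  classical
  constructor
  · rintro ⟨p, -, hp⟩
    exact ⟨hp x p.start_mem_support, p.reachable_edgesWithin hp⟩
  · rintro ⟨hx, ⟨p⟩⟩
    refine ⟨(p.mapLe (edgesWithin_le _)).bypass, Walk.bypass_isPath _, fun w hw => ?_⟩
    have := Walk.support_bypass_subset_support _ hw
    rw [Walk.support_mapLe_eq_support] at this
    exact p.support_subset_of_edgesWithin hx w this

theorem HasPathMissing.left {x y z : V} (h : HasPathMissing G x y z) : x ∈ farFrom G z :=
  (hasPathMissing_iff.1 h).1

theorem HasPathMissing.symm {x y z : V} (h : HasPathMissing G x y z) : HasPathMissing G y x z := by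
  rw [hasPathMissing_iff] at *
  exact ⟨mem_of_reachable_edgesWithin h.2 h.1, h.2.symm⟩

theorem HasPathMissing.right {x y z : V} (h : HasPathMissing G x y z) : y ∈ farFrom G z :=
  h.symm.left

theorem HasPathMissing.trans {x y z w : V} (h : HasPathMissing G x y z)
    (h' : HasPathMissing G y w z) : HasPathMissing G x w z := by
  rw [hasPathMissing_iff] at *
  exact ⟨h.1, h.2.trans h'.2⟩

theorem HasPathMissing.of_adj {x y z : V} (hx : x ∈ farFrom G z) (hy : y ∈ farFrom G z)
    (h : G.Adj x y) : HasPathMissing G x y z :=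
  hasPathMissing_iff.2 ⟨hx, Adj.reachable ⟨h, hx, hy⟩⟩

theorem HasPathMissing.reachable {x y z : V} (h : HasPathMissing G x y z) : G.Reachable x y :=
  h.choose.reachable

/-- Cut a walk at its first exit from `S`: the part before the cut stays inside `S`. -/
theorem SimpleGraph.Reachable.exists_exit {S : Set V} {a b : V} (h : G.Reachable a b)
    (ha : a ∈ S) (hb : b ∉ S) :
    ∃ c ∈ S, ∃ d ∉ S, (edgesWithin G S).Reachable a c ∧ G.Adj c d := by
  obtain ⟨p⟩ := h
  induction p with
  | nil => exact absurd ha hb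
  | @cons u v w hadj p ih =>
    by_cases hv : v ∈ S
    · obtain ⟨c, hc, d, hd, hr, had⟩ := ih hv hb
      have h1 : (edgesWithin G S).Adj u v := ⟨hadj, ha, hv⟩
      exact ⟨c, hc, d, hd, h1.reachable.trans hr, had⟩
    · exact ⟨u, ha, v, hv, Reachable.refl _, hadj⟩

theorem SimpleGraph.Reachable.exists_geodesic {u v : V} (h : G.Reachable u v) :
    ∃ f : ℕ → V, f 0 = u ∧ f (G.dist u v) = v ∧
      (∀ i < G.dist u v, G.Adj (f i) (f (i + 1))) ∧
      (∀ i ≤ G.dist u v, G.dist u (f i) = i ∧ G.dist (f i) v = G.dist u v - i) := by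
  obtain ⟨p, hp⟩ := h.exists_walk_length_eq_dist
  have hadj : ∀ i < G.dist u v, G.Adj (p.getVert i) (p.getVert (i + 1)) := fun i hi =>
    p.adj_getVert_succ (by omega)
  refine ⟨p.getVert, p.getVert_zero, by rw [← hp]; exact p.getVert_length, hadj, ?_⟩
  intro i hi
  have h1 : G.dist u (p.getVert i) ≤ i :=
    (dist_le (p.take i)).trans (by rw [Walk.take_length]; omega)
  have h2 : G.dist (p.getVert i) v ≤ G.dist u v - i :=
    (dist_le (p.drop i)).trans (by rw [Walk.drop_length]; omega)
  have h3 : G.dist u v ≤ G.dist u (p.getVert i) + G.dist (p.getVert i) v :=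
    (p.take i).reachable.dist_triangle_left v
  omega

theorem reachable_of_chain {H : SimpleGraph V} {f : ℕ → V} {k m : ℕ}
    (h : ∀ i, k ≤ i → i < m → H.Adj (f i) (f (i + 1))) :
    ∀ i, k ≤ i → i ≤ m → H.Reachable (f k) (f i) := by
  intro i hk
  induction i, hk using Nat.le_induction with
  | base => intro _; exact Reachable.refl _
  | succ i hi ih => intro hm; exact (ih (by omega)).trans (h i hi (by omega)).reachable

theorem hasPathMissing_of_chain {f : ℕ → V} {k m : ℕ} {x : V} (hkm : k ≤ m)
    (h : ∀ i, k ≤ i → i < m → G.Adj (f i) (f (i + 1)))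
    (hf : ∀ i, k ≤ i → i ≤ m → f i ∈ farFrom G x) : HasPathMissing G (f k) (f m) x := by
  refine hasPathMissing_iff.2 ⟨hf k le_rfl hkm, reachable_of_chain (m := m) ?_ m hkm le_rfl⟩
  intro i hk hm
  exact ⟨h i hk hm, hf i hk hm.le, hf (i + 1) (by omega) (by omega)⟩

/-- Two vertices of the same component of `G - N[x]` which both have a neighbour in `N(x)` have
the same neighbours in `N(x)`. -/
def HasUniformAttachments (G : SimpleGraph V) : Prop :=
  ∀ x c d u v, G.Adj x c → G.Adj x d → G.Adj c u → G.Adj d v → HasPathMissing G u v x → G.Adj c v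

/-- Suppose the `G`-geodesic `h` is shorter than the `H`-geodesic `g`. From index 2 on both run in
the component of the target in `G - N[f a]`, so uniformity makes `f (g 1)` adjacent to `h 2`. Then
`f (g 1)` is too close to `f b` for the induction hypothesis. -/
theorem HasUniformAttachments.dist_eq (hG : HasUniformAttachments G) {W : Type*}
    {H : SimpleGraph W} {f : W → V} (hf : Function.Injective f)
    (hadj : ∀ a b, H.Reachable a b → (G.Adj (f a) (f b) ↔ H.Adj a b)) :
    ∀ n a b, H.Reachable a b → H.dist a b = n → G.dist (f a) (f b) = n := by
  intro n
  induction n with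
  | zero =>
    intro a b hr h
    rw [hr.dist_eq_zero_iff] at h
    simp [h]
  | succ n ih =>
    intro a b hr hn
    let φ : H →g G := ⟨f, fun {a b} h => (hadj a b h.reachable).2 h⟩
    have hGr : G.Reachable (f a) (f b) := hr.map φ
    have hle : G.dist (f a) (f b) ≤ n + 1 := by
      obtain ⟨p, hp⟩ := hr.exists_walk_length_eq_dist
      calc G.dist (f a) (f b) ≤ (p.map φ).length := dist_le _
        _ = n + 1 := by rw [Walk.length_map, hp, hn]
    by_contra hne
    have hlt : G.dist (f a) (f b) < n + 1 := lt_of_le_of_ne hle hne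
    have hab : a ≠ b := by rintro rfl; simp at hn
    have hd0 : G.dist (f a) (f b) ≠ 0 := by
      rw [Ne, hGr.dist_eq_zero_iff]
      exact hf.ne hab
    have hd1 : G.dist (f a) (f b) ≠ 1 := by
      rw [Ne, dist_eq_one_iff_adj, hadj a b hr, ← dist_eq_one_iff_adj]
      omega
    set d := G.dist (f a) (f b) with hd
    obtain ⟨g, hg0, hgn, hgadj, hgd⟩ := hr.exists_geodesic
    obtain ⟨h, hh0, hhd, hhadj, hhdist⟩ := hGr.exists_geodesic
    rw [hn] at hgn hgadj hgd
    rw [← hd] at hhd hhadj hhdist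
    have hgr : ∀ i ≤ n + 1, H.Reachable a (g i) := by
      intro i hi
      have := reachable_of_chain (H := H) (f := g) (k := 0) (m := n + 1)
        (fun i _ hi => hgadj i hi) i (Nat.zero_le _) hi
      rwa [hg0] at this
    have p1 : HasPathMissing G (f (g 2)) (f (g (n + 1))) (f a) := by
      refine hasPathMissing_of_chain (f := fun i => f (g i)) (by omega)
        (fun i _ hi => (hadj _ _ (hgadj i hi).reachable).2 (hgadj i hi)) ?_
      intro i hi hin
      have h1 := (hgd i hin).1
      constructor
      · intro h2
        have := hf h2
        rw [this, SimpleGraph.dist_self] at h1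
        omega
      · rw [hadj _ _ (hgr i hin), ← dist_eq_one_iff_adj]
        omega
    have p2 : HasPathMissing G (h 2) (h d) (f a) := by
      refine hasPathMissing_of_chain (by omega) (fun i _ hi => hhadj i hi) ?_
      intro i hi hin
      have h1 := (hhdist i hin).1
      constructor
      · intro h2
        rw [h2, SimpleGraph.dist_self] at h1
        omega
      · rw [← dist_eq_one_iff_adj]
        omega
    rw [hgn] at p1
    rw [hhd] at p2
    have e1 : G.Adj (f a) (f (g 1)) := by
      have := hgadj 0 (by omega)
      rw [hg0] at this
      exact (hadj _ _ this.reachable).2 this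
    have e2 : G.Adj (f a) (h 1) := by
      have := hhadj 0 (by omega)
      rwa [hh0] at this
    have e3 : G.Adj (f (g 1)) (f (g 2)) :=
      (hadj _ _ (hgadj 1 (by omega)).reachable).2 (hgadj 1 (by omega))
    have key := hG _ _ _ _ _ e1 e2 e3 (hhadj 1 (by omega)) (p1.trans p2.symm)
    have hr1 : H.Reachable (g 1) b := (hgr 1 (by omega)).symm.trans hr
    have hdist := ih (g 1) b hr1 (by rw [(hgd 1 (by omega)).2]; omega)
    have h4 : G.dist (f (g 1)) (f b) ≤ G.dist (f (g 1)) (h 2) + G.dist (h 2) (f b) :=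
      key.reachable.dist_triangle_left _
    rw [dist_eq_one_iff_adj.2 key, (hhdist 2 (by omega)).2] at h4
    omega

theorem HasUniformAttachments.isDistanceHereditary (hG : HasUniformAttachments G) :
    IsDistanceHereditary G := by
  intro S hS x y
  refine (hG.dist_eq (H := G.induce S) Subtype.val_injective (fun a b _ => ?_) _ x y
    (hS.preconnected x y) rfl).symm
  exact Iff.rfl

/-- Allows geodesics of `G - N[z]` to be measured by distances in `G`, without assuming that `S`
induces a connected graph. -/
theorem HasUniformAttachments.dist_edgesWithin (hG : HasUniformAttachments G) {S : Set V} {a b : V}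
    (hr : (edgesWithin G S).Reachable a b) (ha : a ∈ S) :
    (edgesWithin G S).dist a b = G.dist a b := by
  classical
  have ha' := mem_of_reachable_edgesWithin hr ha
  have := hG.dist_eq (H := G.induce S) (f := Subtype.val) Subtype.val_injective
    (fun a b _ => Iff.rfl) ((G.induce S).dist ⟨a, ha⟩ ⟨b, ha'⟩) ⟨a, ha⟩ ⟨b, ha'⟩
  refine le_antisymm ?_ (hr.dist_anti (edgesWithin_le S))
  have hr' : (G.induce S).Reachable ⟨a, ha⟩ ⟨b, ha'⟩ := by
    obtain ⟨p⟩ := hr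
    have h := p.support_subset_of_edgesWithin ha
    have := (p.mapLe (edgesWithin_le S)).induce S (by
      intro w hw
      rw [Walk.support_mapLe_eq_support] at hw
      exact h w hw)
    exact this.reachable
  obtain ⟨q, hq⟩ := hr'.exists_walk_length_eq_dist
  have h2 := this hr' rfl
  simp only at h2
  rw [h2, ← hq]
  let φ : G.induce S →g edgesWithin G S := ⟨Subtype.val, fun {a b} h => ⟨h, a.2, b.2⟩⟩
  calc _ ≤ (q.map φ).length := dist_le (q.map φ)
    _ = q.length := Walk.length_map _ _

end Basics

/-! ### Forbidden induced subgraphs and uniform attachments. -/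

section Obstructions

variable {V : Type*} {G : SimpleGraph V}

/-- No induced subgraph of `G` is a listed obstruction. -/
def IsObstructionFree (G : SimpleGraph V) : Prop := ∀ S : Set V, ¬ IsListedObstruction (G.induce S)

theorem IsListedObstruction.of_iso {W W' : Type*} {H : SimpleGraph W} {K : SimpleGraph W'}
    (hK : IsListedObstruction K) (e : H ≃g K) : IsListedObstruction H := by
  have tr : ∀ {U : Type} {L : SimpleGraph U}, Nonempty (K ≃g L) → Nonempty (H ≃g L) :=
    fun ⟨f⟩ => ⟨e.trans f⟩
  rcases hK with ⟨n, hn, h⟩ | h | h | h | h | h | h | h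
  · exact Or.inl ⟨n, hn, tr h⟩
  · exact Or.inr (Or.inl (tr h))
  · exact Or.inr (Or.inr (Or.inl (tr h)))
  · exact Or.inr (Or.inr (Or.inr (Or.inl (tr h))))
  · exact Or.inr (Or.inr (Or.inr (Or.inr (Or.inl (tr h)))))
  · exact Or.inr (Or.inr (Or.inr (Or.inr (Or.inr (Or.inl (tr h))))))
  · exact Or.inr (Or.inr (Or.inr (Or.inr (Or.inr (Or.inr (Or.inl (tr h)))))))
  · exact Or.inr (Or.inr (Or.inr (Or.inr (Or.inr (Or.inr (Or.inr (tr h)))))))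

theorem isListedObstruction_cycleGraph {n : ℕ} (hn : 5 ≤ n) :
    IsListedObstruction (cycleGraph n) := Or.inl ⟨n, hn, ⟨Iso.refl⟩⟩

theorem isListedObstruction_dominoGraph : IsListedObstruction dominoGraph :=
  Or.inr (Or.inl ⟨Iso.refl⟩)

theorem isListedObstruction_houseGraph : IsListedObstruction houseGraph :=
  Or.inr (Or.inr (Or.inl ⟨Iso.refl⟩))

theorem isListedObstruction_gemGraph : IsListedObstruction gemGraph :=
  Or.inr (Or.inr (Or.inr (Or.inl ⟨Iso.refl⟩)))

theorem isListedObstruction_graphA1 : IsListedObstruction graphA1 :=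
  Or.inr (Or.inr (Or.inr (Or.inr (Or.inl ⟨Iso.refl⟩))))

theorem isListedObstruction_graphA22 : IsListedObstruction graphA22 :=
  Or.inr (Or.inr (Or.inr (Or.inr (Or.inr (Or.inl ⟨Iso.refl⟩)))))

theorem isListedObstruction_graphA3 : IsListedObstruction graphA3 :=
  Or.inr (Or.inr (Or.inr (Or.inr (Or.inr (Or.inr (Or.inl ⟨Iso.refl⟩))))))

theorem isListedObstruction_graphA23 : IsListedObstruction graphA23 :=
  Or.inr (Or.inr (Or.inr (Or.inr (Or.inr (Or.inr (Or.inr ⟨Iso.refl⟩))))))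

theorem IsObstructionFree.not_embedding (hG : IsObstructionFree G) {W : Type*} {K : SimpleGraph W}
    (hK : IsListedObstruction K) (f : K ↪g G) : False :=
  hG (Set.range f) (hK.of_iso f.isoInduceRange.symm)

instance (n : ℕ) (l : List (Fin n × Fin n)) : DecidableRel (graphOfPairs n l).Adj := fun i j =>
  inferInstanceAs (Decidable (i ≠ j ∧ ((i, j) ∈ l ∨ (j, i) ∈ l)))

/-- A vertex map from a graph on `Fin n` without false twins which respects adjacency and
non-adjacency is an embedding. -/
theorem nonempty_embedding {n : ℕ} {K : SimpleGraph (Fin n)}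
    (hK : ∀ i j, i ≠ j → ∃ k, ¬ (K.Adj i k ↔ K.Adj j k)) (v : Fin n → V)
    (h : ∀ i j, i < j → (G.Adj (v i) (v j) ↔ K.Adj i j)) : Nonempty (K ↪g G) := by
  have h' : ∀ i j, G.Adj (v i) (v j) ↔ K.Adj i j := by
    intro i j
    rcases lt_trichotomy i j with hij | rfl | hij
    · exact h i j hij
    · simp
    · rw [G.adj_comm, K.adj_comm, h j i hij]
  refine ⟨⟨⟨v, fun i j hij => ?_⟩, fun {i j} => h' i j⟩⟩
  by_contra hne
  obtain ⟨k, hk⟩ := hK i j hne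
  rw [← h', ← h', hij] at hk
  exact hk Iff.rfl

theorem IsObstructionFree.not_house (hG : IsObstructionFree G) {a b c d e : V}
    (hab : G.Adj a b) (hac : ¬ G.Adj a c) (had : G.Adj d a) (hae : G.Adj a e)
    (hbc : G.Adj b c) (hbd : ¬ G.Adj b d) (hbe : G.Adj b e)
    (hcd : G.Adj c d) (hce : ¬ G.Adj c e) (hde : ¬ G.Adj d e) : False := by
  obtain ⟨f⟩ := nonempty_embedding (K := houseGraph) (G := G)
    (by unfold houseGraph; decide) ![a, b, c, d, e] (by
      intro i j hij
      fin_cases i <;> fin_cases j <;> first | exact absurd hij (by decide) |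
        simp [houseGraph, graphOfPairs, had.symm, *])
  exact hG.not_embedding isListedObstruction_houseGraph f

theorem IsObstructionFree.not_gem (hG : IsObstructionFree G) {a b c d e : V}
    (hab : G.Adj a b) (hac : ¬ G.Adj a c) (had : ¬ G.Adj a d) (hae : G.Adj a e)
    (hbc : G.Adj b c) (hbd : ¬ G.Adj b d) (hbe : G.Adj b e)
    (hcd : G.Adj c d) (hce : G.Adj c e) (hde : G.Adj d e) : False := by
  obtain ⟨f⟩ := nonempty_embedding (K := gemGraph) (G := G)
    (by unfold gemGraph; decide) ![a, b, c, d, e] (by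
      intro i j hij
      fin_cases i <;> fin_cases j <;> first | exact absurd hij (by decide) |
        simp [gemGraph, graphOfPairs, *])
  exact hG.not_embedding isListedObstruction_gemGraph f

theorem IsObstructionFree.not_domino (hG : IsObstructionFree G) {a b c d e f : V}
    (hab : G.Adj a b) (hac : ¬ G.Adj a c) (had : G.Adj a d) (hae : ¬ G.Adj a e) (haf : G.Adj a f)
    (hbc : G.Adj b c) (hbd : ¬ G.Adj b d) (hbe : ¬ G.Adj b e) (hbf : ¬ G.Adj b f)
    (hcd : G.Adj c d) (hce : ¬ G.Adj c e) (hcf : ¬ G.Adj c f)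
    (hde : G.Adj d e) (hdf : ¬ G.Adj d f) (hef : G.Adj e f) : False := by
  obtain ⟨f⟩ := nonempty_embedding (K := dominoGraph) (G := G)
    (by unfold dominoGraph; decide) ![a, b, c, d, e, f] (by
      intro i j hij
      fin_cases i <;> fin_cases j <;> first | exact absurd hij (by decide) |
        simp [dominoGraph, graphOfPairs, *])
  exact hG.not_embedding isListedObstruction_dominoGraph f

theorem IsObstructionFree.not_net (hG : IsObstructionFree G) {a b c x y z : V}
    (hab : G.Adj a b) (hac : G.Adj a c) (hbc : G.Adj b c)
    (hax : G.Adj a x) (hby : G.Adj b y) (hcz : G.Adj c z)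
    (hay : ¬ G.Adj a y) (haz : ¬ G.Adj a z) (hbx : ¬ G.Adj b x) (hbz : ¬ G.Adj b z)
    (hcx : ¬ G.Adj c x) (hcy : ¬ G.Adj c y)
    (hxy : ¬ G.Adj x y) (hxz : ¬ G.Adj x z) (hyz : ¬ G.Adj y z) : False := by
  obtain ⟨f⟩ := nonempty_embedding (K := graphA22) (G := G)
    (by unfold graphA22; decide) ![a, b, c, x, y, z] (by
      intro i j hij
      fin_cases i <;> fin_cases j <;> first | exact absurd hij (by decide) |
        simp [graphA22, graphOfPairs, *])
  exact hG.not_embedding isListedObstruction_graphA22 f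

theorem IsObstructionFree.not_subdivided_claw (hG : IsObstructionFree G) {w a b c x y z : V}
    (hwa : G.Adj w a) (hwb : G.Adj w b) (hwc : G.Adj w c)
    (hwx : ¬ G.Adj w x) (hwy : ¬ G.Adj w y) (hwz : ¬ G.Adj w z)
    (hab : ¬ G.Adj a b) (hac : ¬ G.Adj a c) (hbc : ¬ G.Adj b c)
    (hax : G.Adj a x) (hby : G.Adj b y) (hcz : G.Adj c z)
    (hay : ¬ G.Adj a y) (haz : ¬ G.Adj a z) (hbx : ¬ G.Adj b x) (hbz : ¬ G.Adj b z)
    (hcx : ¬ G.Adj c x) (hcy : ¬ G.Adj c y)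
    (hxy : ¬ G.Adj x y) (hxz : ¬ G.Adj x z) (hyz : ¬ G.Adj y z) : False := by
  obtain ⟨f⟩ := nonempty_embedding (K := graphA1) (G := G)
    (by unfold graphA1; decide) ![w, a, b, c, x, y, z] (by
      intro i j hij
      fin_cases i <;> fin_cases j <;> first | exact absurd hij (by decide) |
        simp [graphA1, graphOfPairs, *])
  exact hG.not_embedding isListedObstruction_graphA1 f

/-- Excludes `A₃` and `A₂,₃` together: `a, b, c` is an induced path, `w` a further common
neighbour of `a` and `c`, and `x, y, z` are pendant at `a, b, c`. -/
theorem IsObstructionFree.not_pendant_diamond_or_square (hG : IsObstructionFree G)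
    {w a b c x y z : V}
    (hwa : G.Adj w a) (hwc : G.Adj w c)
    (hwx : ¬ G.Adj w x) (hwy : ¬ G.Adj w y) (hwz : ¬ G.Adj w z)
    (hab : G.Adj a b) (hac : ¬ G.Adj a c) (hbc : G.Adj b c)
    (hax : G.Adj a x) (hby : G.Adj b y) (hcz : G.Adj c z)
    (hay : ¬ G.Adj a y) (haz : ¬ G.Adj a z) (hbx : ¬ G.Adj b x) (hbz : ¬ G.Adj b z)
    (hcx : ¬ G.Adj c x) (hcy : ¬ G.Adj c y)
    (hxy : ¬ G.Adj x y) (hxz : ¬ G.Adj x z) (hyz : ¬ G.Adj y z) : False := by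
  by_cases hbw : G.Adj b w
  · obtain ⟨f⟩ := nonempty_embedding (K := graphA23) (G := G)
      (by unfold graphA23; decide) ![a, w, c, b, x, z, y] (by
        intro i j hij
        fin_cases i <;> fin_cases j <;> first | exact absurd hij (by decide) |
          simp [graphA23, graphOfPairs, G.adj_comm z y, hwa.symm, hbc.symm, hbw.symm, *])
    exact hG.not_embedding isListedObstruction_graphA23 f
  · obtain ⟨f⟩ := nonempty_embedding (K := graphA3) (G := G)
      (by unfold graphA3; decide) ![a, b, c, w, x, y, z] (by
        intro i j hij
        fin_cases i <;> fin_cases j <;> first | exact absurd hij (by decide) |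
          simp [graphA3, graphOfPairs, hwa.symm, hwc.symm, *])
    exact hG.not_embedding isListedObstruction_graphA3 f

/-- `f 0, …, f m` is an induced path. -/
def IsInducedPathSeq (G : SimpleGraph V) (f : ℕ → V) (m : ℕ) : Prop :=
  ∀ i ≤ m, ∀ j ≤ m, (f i = f j → i = j) ∧ (G.Adj (f i) (f j) ↔ i + 1 = j ∨ j + 1 = i)

/-- The sequence `f` with `e` put in front. -/
def prependSeq (e : V) (f : ℕ → V) : ℕ → V
  | 0 => e
  | i + 1 => f i

theorem IsInducedPathSeq.prepend {f : ℕ → V} {m : ℕ} (hf : IsInducedPathSeq G f m) {e : V}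
    (he : ∀ i ≤ m, e ≠ f i) (hadj : ∀ i ≤ m, (G.Adj e (f i) ↔ i = 0)) :
    IsInducedPathSeq G (prependSeq e f) (m + 1) := by
  rintro (_ | i) hi (_ | j) hj
  · simp [prependSeq]
  · have h1 := he j (by omega)
    have h2 := hadj j (by omega)
    simp only [prependSeq, h2]
    refine ⟨fun h => absurd h h1, by omega⟩
  · have h1 := he i (by omega)
    have h2 := hadj i (by omega)
    simp only [prependSeq, G.adj_comm _ e, h2]
    refine ⟨fun h => absurd h.symm h1, by omega⟩
  · have := hf i (by omega) j (by omega)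
    simp only [prependSeq]
    refine ⟨fun h => by rw [this.1 h], by rw [this.2]; omega⟩

theorem cycleGraph_adj_of_lt {m : ℕ} {i j : Fin (m + 2)} (hij : (i : ℕ) < j) :
    (cycleGraph (m + 2)).Adj i j ↔ (i : ℕ) + 1 = j ∨ ((i : ℕ) = 0 ∧ (j : ℕ) = m + 1) := by
  obtain ⟨i, hi⟩ := i
  obtain ⟨j, hj⟩ := j
  simp only at hij
  rw [cycleGraph_adj', Fin.sub_def, Fin.sub_def]
  simp only
  have h1 : (m + 2 - i + j) % (m + 2) = j - i := by
    rw [show m + 2 - i + j = (j - i) + (m + 2) by omega, Nat.add_mod_right,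
      Nat.mod_eq_of_lt (by omega)]
  have h2 : (m + 2 - j + i) % (m + 2) = m + 2 - j + i := Nat.mod_eq_of_lt (by omega)
  rw [h1, h2]
  omega

/-- The vertex `e` closes the path into an induced cycle on `m + 2` vertices, hence the bound 3. -/
theorem IsObstructionFree.not_hole (hG : IsObstructionFree G) {f : ℕ → V} {m : ℕ} (hm : 3 ≤ m)
    (hf : IsInducedPathSeq G f m) {e : V} (he : ∀ i ≤ m, e ≠ f i)
    (hadj : ∀ i ≤ m, (G.Adj e (f i) ↔ i = 0 ∨ i = m)) : False := by
  let φ : Fin (m + 2) → V := fun i => prependSeq e f i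
  have key : ∀ i j : Fin (m + 2), i < j →
      φ i ≠ φ j ∧ (G.Adj (φ i) (φ j) ↔ (cycleGraph (m + 2)).Adj i j) := by
    rintro ⟨i, hi⟩ ⟨j, hj⟩ hij
    rw [Fin.mk_lt_mk] at hij
    have hc : (cycleGraph (m + 2)).Adj ⟨i, hi⟩ ⟨j, hj⟩ ↔ i + 1 = j ∨ (i = 0 ∧ j = m + 1) :=
      cycleGraph_adj_of_lt hij
    rw [hc]
    cases j with
    | zero => omega
    | succ j =>
      cases i with
      | zero =>
        simp only [φ, prependSeq]
        refine ⟨he j (by omega), ?_⟩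
        rw [hadj j (by omega)]
        simp only [true_and]
        omega
      | succ i =>
        simp only [φ, prependSeq]
        have := hf i (by omega) j (by omega)
        refine ⟨fun h => ?_, ?_⟩
        · have := this.1 h
          omega
        · rw [this.2]
          omega
  have hinj : Function.Injective φ := by
    intro i j hij
    rcases lt_trichotomy i j with h | h | h
    · exact absurd hij (key i j h).1
    · exact h
    · exact absurd hij.symm (key j i h).1
  have hiff : ∀ i j, G.Adj (φ i) (φ j) ↔ (cycleGraph (m + 2)).Adj i j := by
    intro i j
    rcases lt_trichotomy i j with h | rfl | h
    · exact (key i j h).2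
    · simp
    · rw [G.adj_comm, (cycleGraph (m + 2)).adj_comm]
      exact (key j i h).2
  exact hG.not_embedding (isListedObstruction_cycleGraph (n := m + 2) (by omega))
    ⟨⟨φ, hinj⟩, fun {i j} => hiff i j⟩

theorem SimpleGraph.Reachable.exists_inducedPathSeq {u v : V} (h : G.Reachable u v) :
    ∃ f : ℕ → V, f 0 = u ∧ f (G.dist u v) = v ∧ IsInducedPathSeq G f (G.dist u v) ∧
      ∀ i ≤ G.dist u v, G.Reachable u (f i) ∧ G.Reachable (f i) v ∧
        G.dist u (f i) = i ∧ G.dist (f i) v = G.dist u v - i := by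
  obtain ⟨f, h0, h1, hadj, hd⟩ := h.exists_geodesic
  have hr : ∀ i ≤ G.dist u v, G.Reachable u (f i) := fun i hi => by
    have := reachable_of_chain (k := 0) (fun i _ h => hadj i h) i (Nat.zero_le _) hi
    rwa [h0] at this
  refine ⟨f, h0, h1, fun i hi j hj => ⟨fun hij => ?_, fun hij => ?_, ?_⟩,
    fun i hi => ⟨hr i hi, (hr i hi).symm.trans h, hd i hi⟩⟩
  · rw [← (hd i hi).1, hij, (hd j hj).1]
  · have h2 := (hr i hi).dist_triangle_left (f j)
    have h3 := (hr j hj).dist_triangle_left (f i)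
    rw [dist_eq_one_iff_adj.2 hij, (hd i hi).1, (hd j hj).1] at h2
    rw [dist_eq_one_iff_adj.2 hij.symm, (hd i hi).1, (hd j hj).1] at h3
    have h4 : i ≠ j := by rintro rfl; exact hij.ne rfl
    omega
  · rintro (rfl | rfl)
    · exact hadj i (by omega)
    · exact (hadj j (by omega)).symm

theorem IsInducedPathSeq.of_edgesWithin {S : Set V} {f : ℕ → V} {m : ℕ}
    (h : IsInducedPathSeq (edgesWithin G S) f m) (hf : ∀ i ≤ m, f i ∈ S) :
    IsInducedPathSeq G f m := by
  intro i hi j hj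
  refine ⟨(h i hi j hj).1, ?_⟩
  rw [← (h i hi j hj).2]
  exact ⟨fun hij => ⟨hij, hf i hi, hf j hj⟩, fun hij => hij.1⟩

/-- Induction on the distance of `u` and `v` in `G - N[x]`. In a minimal failure a geodesic from `u`
to `v` together with `c`, `d` and possibly `x` contains a hole, house, gem or domino. -/
theorem IsObstructionFree.hasUniformAttachments (hG : IsObstructionFree G) :
    HasUniformAttachments G := by
  intro x
  have main : ∀ n c d u v, G.Adj x c → G.Adj x d → G.Adj c u → G.Adj d v →
      HasPathMissing G u v x → (edgesWithin G (farFrom G x)).dist u v = n → G.Adj c v := by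
    intro n
    induction n using Nat.strong_induction_on with
    | _ n ih =>
    intro c d u v hxc hxd hcu hdv huv hn
    by_contra hcv
    rw [hasPathMissing_iff] at huv
    obtain ⟨hu, hr⟩ := huv
    obtain ⟨f, hf0, hfn, hind, hf⟩ := hr.exists_inducedPathSeq
    rw [hn] at hfn hind hf
    have hfar : ∀ i ≤ n, f i ∈ farFrom G x := fun i hi =>
      mem_of_reachable_edgesWithin (hf i hi).1 hu
    have hP : IsInducedPathSeq G f n := hind.of_edgesWithin hfar
    -- An interior vertex with a neighbour in N(x) would be adjacent to `c` by induction on the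
    -- first part of the geodesic, and then so would `v` by induction on the second.
    have hint : ∀ i ≤ n, 0 < i → i < n → ∀ g, G.Adj x g → ¬ G.Adj g (f i) := by
      intro i hi h0 h1 g hxg hgi
      have hc := ih i h1 c g u (f i) hxc hxg hcu hgi
        (hasPathMissing_iff.2 ⟨hu, (hf i hi).1⟩) (hf i hi).2.2.1
      exact hcv (ih (n - i) (by omega) c d (f i) v hxc hxd hc hdv
        (hasPathMissing_iff.2 ⟨hfar i hi, (hf i hi).2.1⟩) (hf i hi).2.2.2)
    have hn0 : n ≠ 0 := by
      rintro rfl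
      rw [hf0] at hfn
      exact hcv (hfn ▸ hcu)
    have hx : ∀ i ≤ n, x ≠ f i ∧ ¬ G.Adj x (f i) := fun i hi => ⟨(hfar i hi).1.symm, (hfar i hi).2⟩
    have hcne : ∀ i ≤ n, c ≠ f i := fun i hi h => (hx i hi).2 (h ▸ hxc)
    have hdne : ∀ i ≤ n, d ≠ f i := fun i hi h => (hx i hi).2 (h ▸ hxd)
    have hcadj : ∀ i ≤ n, (G.Adj c (f i) ↔ i = 0) := by
      intro i hi
      constructor
      · intro h
        by_contra h0
        rcases hi.lt_or_eq with h1 | rfl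
        · exact hint i hi (by omega) h1 c hxc h
        · exact hcv (hfn ▸ h)
      · rintro rfl
        rwa [hf0]
    have hdadj : ∀ i ≤ n, (G.Adj d (f i) ↔ i = n ∨ (i = 0 ∧ G.Adj d u)) := by
      intro i hi
      constructor
      · intro h
        rcases Nat.eq_zero_or_pos i with rfl | h0
        · exact Or.inr ⟨rfl, hf0 ▸ h⟩
        · rcases hi.lt_or_eq with h1 | rfl
          · exact absurd h (hint i hi h0 h1 d hxd)
          · exact Or.inl rfl
      · rintro (rfl | ⟨rfl, h⟩)
        · rwa [hfn]
        · rwa [hf0]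
    have hcd : c ≠ d := by rintro rfl; exact hcv hdv
    have hxu : ¬ G.Adj x u := hf0 ▸ (hx 0 (by omega)).2
    have hxv : ¬ G.Adj x v := hfn ▸ (hx n le_rfl).2
    have hPc := hP.prepend hcne hcadj
    -- Now `c` sees only `u` on the geodesic, and `d` sees `v` and perhaps `u`. If `d` sees `u`, the
    -- cycle through `d` is a hole unless `n` is 1 or 2. Otherwise the cycle is closed by the edge
    -- `cd` or by `x`.
    by_cases hdu : G.Adj d u
    · rcases Nat.lt_or_ge n 3 with hn3 | hn3
      · obtain rfl | rfl : n = 1 ∨ n = 2 := by omega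
        · have huv : G.Adj u v := by
            have := (hP 0 (by omega) 1 le_rfl).2.2 (by simp)
            rwa [hf0, hfn] at this
          by_cases h : G.Adj c d
          · exact hG.not_gem hxc hxu hxv hxd hcu hcv h huv hdu.symm hdv.symm
          · exact hG.not_house (a := u) (b := d) (c := x) (d := c) (e := v) hdu.symm
              (fun h => hxu h.symm) hcu huv hxd.symm (fun h' => h h'.symm) hdv hxc hxv hcv
        · have huw : G.Adj u (f 1) := by
            have := (hP 0 (by omega) 1 (by omega)).2.2 (by simp)
            rwa [hf0] at this
          have hwv : G.Adj (f 1) v := by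
            have := (hP 1 (by omega) 2 le_rfl).2.2 (by simp)
            rwa [hfn] at this
          have huv : ¬ G.Adj u v := by
            have := (hP 0 (by omega) 2 le_rfl).2
            rw [hf0, hfn] at this
            rw [this]
            omega
          have hcw := hint 1 (by omega) (by omega) (by omega) c hxc
          have hdw := hint 1 (by omega) (by omega) (by omega) d hxd
          have hxw := (hx 1 (by omega)).2
          by_cases h : G.Adj c d
          · exact hG.not_house (a := d) (b := u) (c := f 1) (d := v) (e := c) hdu hdw hdv.symm
              h.symm huw huv hcu.symm hwv (fun h => hcw h.symm) (fun h => hcv h.symm)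
          · exact hG.not_domino (a := u) (b := f 1) (c := v) (d := d) (e := x) (f := c) huw huv
              hdu.symm (fun h => hxu h.symm) hcu.symm hwv (fun h => hdw h.symm)
              (fun h => hxw h.symm) (fun h => hcw h.symm) hdv.symm (fun h => hxv h.symm)
              (fun h => hcv h.symm) hxd.symm (fun h' => h h'.symm) hxc
      · refine hG.not_hole hn3 hP hdne fun i hi => ?_
        rw [hdadj i hi]
        simp only [hdu, and_true]
        omega
    · by_cases h : G.Adj c d
      · rcases Nat.lt_or_ge n 2 with hn2 | hn2
        · obtain rfl : n = 1 := by omega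
          have huv : G.Adj u v := by
            have := (hP 0 (by omega) 1 le_rfl).2.2 (by simp)
            rwa [hf0, hfn] at this
          exact hG.not_house (a := c) (b := d) (c := v) (d := u) (e := x) h hcv hcu.symm hxc.symm
            hdv hdu hxd.symm huv.symm (fun h => hxv h.symm) (fun h => hxu h.symm)
        · refine hG.not_hole (m := n + 1) (by omega) hPc (e := d) ?_ ?_
          · rintro (_ | i) hi
            · exact hcd.symm
            · exact hdne i (by omega)
          · rintro (_ | i) hi
            · simpa [prependSeq] using h.symm
            · simp only [prependSeq]
              rw [hdadj i (by omega)]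
              simp only [hdu, and_false, or_false]
              omega
      · have hPx : IsInducedPathSeq G (prependSeq x (prependSeq c f)) (n + 1 + 1) := by
          refine hPc.prepend ?_ ?_
          · rintro (_ | i) hi
            · exact hxc.ne
            · exact (hx i (by omega)).1
          · rintro (_ | i) hi
            · simpa [prependSeq] using hxc
            · simpa [prependSeq] using (hx i (by omega)).2
        refine hG.not_hole (m := n + 1 + 1) (by omega) hPx (e := d) ?_ ?_
        · rintro (_ | _ | i) hi
          · exact hxd.ne.symm
          · exact hcd.symm
          · exact hdne i (by omega)
        · rintro (_ | _ | i) hi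
          · simpa [prependSeq] using hxd.symm
          · simp [prependSeq, G.adj_comm d c, h]
          · simp only [prependSeq]
            rw [hdadj i (by omega)]
            simp only [hdu, and_false, or_false]
            omega
  intro c d u v h1 h2 h3 h4 h5
  exact main _ c d u v h1 h2 h3 h4 h5 rfl

end Obstructions

/-! ### Asteroidal triples of minimal total distance. -/

section AsteroidalTriples

variable {V : Type*} {G : SimpleGraph V}

theorem IsAsteroidalTriple.of_paths {x y z : V} (hxy : HasPathMissing G x y z)
    (hyz : HasPathMissing G y z x) (hxz : HasPathMissing G x z y) : IsAsteroidalTriple G x y z :=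
  ⟨hyz.left.1.symm, hxz.right.1.symm, hxy.left.1, hxy, hyz, hxz⟩

theorem IsAsteroidalTriple.rotate {x y z : V} (h : IsAsteroidalTriple G x y z) :
    IsAsteroidalTriple G y z x :=
  .of_paths h.2.2.2.2.1 h.2.2.2.2.2.symm h.2.2.2.1.symm

theorem IsAsteroidalTriple.swap {x y z : V} (h : IsAsteroidalTriple G x y z) :
    IsAsteroidalTriple G y x z :=
  .of_paths h.2.2.2.1.symm h.2.2.2.2.2 h.2.2.2.2.1

/-- `c` is a neighbour of `x` with a neighbour in the component of `G - N[x]` containing `y`. -/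
def IsAttachment (G : SimpleGraph V) (x y c : V) : Prop :=
  G.Adj x c ∧ ∃ u, G.Adj c u ∧ HasPathMissing G u y x

theorem IsAttachment.congr {x y z c : V} (h : IsAttachment G x y c)
    (hyz : HasPathMissing G y z x) : IsAttachment G x z c :=
  ⟨h.1, h.2.imp fun _ hu => ⟨hu.1, hu.2.trans hyz⟩⟩

theorem IsAttachment.reachable {x y c : V} (h : IsAttachment G x y c) : G.Reachable x y := by
  obtain ⟨hx, u, hu, hp⟩ := h
  exact hx.reachable.trans (hu.reachable.trans hp.reachable)

/-- The second vertex of a geodesic from `x` to `t` is itself an attachment, so by uniformity `c`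
can take its place. -/
theorem IsAttachment.dist (hG : HasUniformAttachments G) {x y t c : V} (h : IsAttachment G x y c)
    (hyt : HasPathMissing G y t x) : G.dist c t + 1 = G.dist x t := by
  replace h := h.congr hyt
  have htx := hyt.right
  have hr := h.reachable
  have h2 := hr.one_lt_dist_of_ne_of_not_adj htx.1.symm htx.2
  obtain ⟨f, hf0, hft, hadj, hd⟩ := hr.exists_geodesic
  set d := G.dist x t
  have hp : HasPathMissing G (f 2) (f d) x := by
    refine hasPathMissing_of_chain (by omega) (fun i _ hi => hadj i hi) fun i h2i hid => ?_
    have := (hd i hid).1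
    refine ⟨fun h => ?_, fun h => ?_⟩
    · rw [h, SimpleGraph.dist_self] at this
      omega
    · rw [dist_eq_one_iff_adj.2 h] at this
      omega
  rw [hft] at hp
  obtain ⟨hxc, u, hcu, hu⟩ := h
  have hx1 : G.Adj x (f 1) := by
    have := hadj 0 (by omega)
    rwa [hf0] at this
  have hc2 := hG x c (f 1) u (f 2) hxc hx1 hcu (hadj 1 (by omega)) (hu.trans hp.symm)
  have h3 := hc2.reachable.dist_triangle_left t
  have h4 := hxc.reachable.dist_triangle_left t
  rw [dist_eq_one_iff_adj.2 hc2, (hd 2 (by omega)).2] at h3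
  rw [dist_eq_one_iff_adj.2 hxc] at h4
  omega

/-- Follow the path from `z` until it first enters N[x]. The entry vertex cannot be `x`, since its
predecessor is not adjacent to `x`. -/
theorem HasPathMissing.exists_isAttachment {x y z : V} (h : HasPathMissing G x z y)
    (hz : z ∈ farFrom G x) : ∃ c, IsAttachment G x z c ∧ c ∈ farFrom G y := by
  have hr := (hasPathMissing_iff.1 h).2.symm
  obtain ⟨u, hu, c, hc, hzu, huc⟩ := hr.exists_exit (S := farFrom G x) hz (fun h => h.1 rfl)
  have hxc : G.Adj x c := by
    by_contra hxc
    refine hc ⟨?_, hxc⟩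
    rintro rfl
    exact hu.2 huc.1.symm
  exact ⟨c, ⟨hxc, u, huc.1.symm, HasPathMissing.symm (hasPathMissing_iff.2
    ⟨hz, hzu.mono (edgesWithin_mono_left (edgesWithin_le _) _)⟩)⟩, huc.2.2⟩

/-- An asteroidal triple together with a choice of attachments. -/
structure IsAttachedTriple (G : SimpleGraph V) (x y z a b c : V) : Prop where
  triple : IsAsteroidalTriple G x y z
  fst : IsAttachment G x y a
  snd : IsAttachment G y z b
  trd : IsAttachment G z x c

namespace IsAttachedTriple

variable {x y z a b c : V}

theorem rotate (h : IsAttachedTriple G x y z a b c) : IsAttachedTriple G y z x b c a :=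
  ⟨h.triple.rotate, h.snd, h.trd, h.fst⟩

theorem swap (h : IsAttachedTriple G x y z a b c) : IsAttachedTriple G y x z b a c :=
  ⟨h.triple.swap, h.snd.congr h.triple.2.2.2.2.2.symm, h.fst.congr h.triple.2.2.2.2.1,
    h.trd.congr h.triple.2.2.2.1⟩

/-- The x-z path missing `y` yields some attachment of `x` outside N[y]; by uniformity `a` cannot be
adjacent to `y` either. -/
theorem fst_mem_farFrom (hG : HasUniformAttachments G) (h : IsAttachedTriple G x y z a b c) :
    a ∈ farFrom G y := by
  obtain ⟨-, -, -, hxy, hyz, hxz⟩ := h.triple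
  refine ⟨fun h' => hyz.left.2 (h' ▸ h.fst.1), fun hya => ?_⟩
  obtain ⟨a', ha', hfar⟩ := hxz.exists_isAttachment hyz.right
  obtain ⟨hxa', u, hu, huz⟩ := ha'
  exact hfar.2 (hG x a' a u y hxa' h.fst.1 hu hya.symm (huz.trans hyz.symm)).symm

theorem fst_mem_farFrom' (hG : HasUniformAttachments G) (h : IsAttachedTriple G x y z a b c) :
    a ∈ farFrom G z :=
  h.swap.rotate.fst_mem_farFrom hG

/-- If `ac` is a non-edge, then `a` and `c` have distance 2, and this distance is also attained in
`G - N[y]`. So they have a common neighbour outside N[y], which completes A₃ or A₂,₃. -/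
theorem adj_of_two (hG : HasUniformAttachments G) (hO : IsObstructionFree G)
    (h : IsAttachedTriple G x y z a b c) (hab : G.Adj a b) (hbc : G.Adj b c) : G.Adj a c := by
  by_contra hac
  obtain ⟨-, -, -, hxy, hyz, hxz⟩ := h.triple
  have hay := h.fst_mem_farFrom hG
  have haz := h.fst_mem_farFrom' hG
  have hbz := h.rotate.fst_mem_farFrom hG
  have hbx := h.rotate.fst_mem_farFrom' hG
  have hcx := h.rotate.rotate.fst_mem_farFrom hG
  have hcy := h.rotate.rotate.fst_mem_farFrom' hG
  have hp : HasPathMissing G a c y :=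
    (HasPathMissing.of_adj hay hxz.left h.fst.1.symm).trans
      (hxz.trans (HasPathMissing.of_adj hxz.right hcy h.trd.1))
  have hac' : a ≠ c := by
    rintro rfl
    exact haz.2 h.trd.1
  have hd : G.dist a c = 2 := by
    have h1 := hp.reachable.one_lt_dist_of_ne_of_not_adj hac' hac
    have h2 := hab.reachable.dist_triangle_left c
    rw [dist_eq_one_iff_adj.2 hab, dist_eq_one_iff_adj.2 hbc] at h2
    omega
  have hr := (hasPathMissing_iff.1 hp).2
  rw [← hG.dist_edgesWithin hr hay] at hd
  obtain ⟨f, hf0, hf2, hadj, -⟩ := hr.exists_geodesic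
  rw [hd] at hf2 hadj
  have haw := hadj 0 (by omega)
  have hwc := hadj 1 (by omega)
  rw [hf0] at haw
  rw [hf2] at hwc
  have hxw : ¬ G.Adj x (f 1) := fun hxw =>
    hac (hG x a (f 1) b c h.fst.1 hxw hab hwc.1 (.of_adj hbx hcx hbc))
  have hzw : ¬ G.Adj z (f 1) := fun hzw =>
    hac (hG z c (f 1) b a h.trd.1 hzw hbc.symm haw.1.symm (.of_adj hbz haz hab.symm)).symm
  exact hO.not_pendant_diamond_or_square haw.1.symm hwc.1 (fun h => hxw h.symm)
    (fun h => haw.2.2.2 h.symm) (fun h => hzw h.symm) hab hac hbc h.fst.1.symm h.snd.1.symm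
    h.trd.1.symm (fun h => hay.2 h.symm) (fun h => haz.2 h.symm) (fun h => hbx.2 h.symm)
    (fun h => hbz.2 h.symm) (fun h => hcx.2 h.symm) (fun h => hcy.2 h.symm) hyz.left.2 hyz.right.2
    hxz.right.2

/-- The descent step: moving `z` to `c` lowers the sum of distances by 2. -/
theorem replace_trd (hG : HasUniformAttachments G) (h : IsAttachedTriple G x y z a b c)
    (hp : HasPathMissing G x y c) : IsAsteroidalTriple G x y c ∧
      G.dist x c + 1 = G.dist x z ∧ G.dist y c + 1 = G.dist y z := by
  obtain ⟨-, -, -, hxy, hyz, hxz⟩ := h.triple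
  have hcx := h.rotate.rotate.fst_mem_farFrom hG
  have hcy := h.rotate.rotate.fst_mem_farFrom' hG
  refine ⟨.of_paths hp (hyz.trans (.of_adj hyz.right hcx h.trd.1))
    (hxz.trans (.of_adj hxz.right hcy h.trd.1)), ?_, ?_⟩
  · rw [G.dist_comm, h.trd.dist hG (hxy.trans hxy.symm), G.dist_comm]
  · rw [G.dist_comm, h.trd.dist hG hxy, G.dist_comm]

theorem hasPathMissing_trd_of_adj (hG : HasUniformAttachments G)
    (h : IsAttachedTriple G x y z a b c) (hab : G.Adj a b) (hac : ¬ G.Adj a c)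
    (hbc : ¬ G.Adj b c) : HasPathMissing G x y c := by
  obtain ⟨-, -, -, hxy, hyz, hxz⟩ := h.triple
  have hxc := mem_farFrom_comm.1 (h.rotate.rotate.fst_mem_farFrom hG)
  have hyc := mem_farFrom_comm.1 (h.rotate.rotate.fst_mem_farFrom' hG)
  have ha : a ∈ farFrom G c := by
    refine ⟨?_, fun h => hac h.symm⟩
    rintro rfl
    exact hbc hab.symm
  have hb : b ∈ farFrom G c := by
    refine ⟨?_, fun h => hbc h.symm⟩
    rintro rfl
    exact hac hab
  exact (HasPathMissing.of_adj hxc ha h.fst.1).trans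
    ((HasPathMissing.of_adj ha hb hab).trans (.of_adj hb hyc h.snd.1.symm))

/-- A shortest x-y path in `G - N[z]` must meet N[c], and not in `c`, which is adjacent to `z`. The
meeting vertex is within distance 2 of `z` through `c`. -/
theorem exists_common (hG : HasUniformAttachments G) (h : IsAttachedTriple G x y z a b c)
    (hp : ¬ HasPathMissing G x y c) : ∃ w, G.Adj c w ∧ w ∈ farFrom G z ∧
      G.dist x w + G.dist w y ≤ G.dist x y ∧ G.dist x z ≤ G.dist x w + 2 ∧
      G.dist y z ≤ G.dist w y + 2 := by
  obtain ⟨-, -, -, hxy, hyz, hxz⟩ := h.triple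
  obtain ⟨hxz', hr⟩ := hasPathMissing_iff.1 hxy
  obtain ⟨f, hf0, hfd, hind, hf⟩ := hr.exists_inducedPathSeq
  rw [hG.dist_edgesWithin hr hxz'] at hfd hind hf
  have hfar : ∀ i ≤ G.dist x y, f i ∈ farFrom G z := fun i hi =>
    mem_of_reachable_edgesWithin (hf i hi).1 hxz'
  have hind' := hind.of_edgesWithin hfar
  have : ∃ i ≤ G.dist x y, f i ∉ farFrom G c := by
    by_contra! hcon
    apply hp
    have := hasPathMissing_of_chain (G := G) (f := f) (k := 0) (m := G.dist x y) (x := c)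
      (Nat.zero_le _) (fun i _ hi => (hind' i hi.le (i + 1) hi).2.2 (Or.inl rfl))
      (fun i _ hi => hcon i hi)
    rwa [hf0, hfd] at this
  obtain ⟨i, hi, hic⟩ := this
  have hcw : G.Adj c (f i) := by
    by_contra hcw
    refine hic ⟨?_, hcw⟩
    intro h'
    exact (hfar i hi).2 (h' ▸ h.trd.1)
  obtain ⟨h1, h2, h3, h4⟩ := hf i hi
  have h3' := h1.dist_anti (edgesWithin_le _)
  have h4' := h2.dist_anti (edgesWithin_le _)
  have hwz : G.dist (f i) z ≤ 2 := by
    have := hcw.symm.reachable.dist_triangle_left z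
    rwa [dist_eq_one_iff_adj.2 hcw.symm, dist_eq_one_iff_adj.2 h.trd.1.symm] at this
  have h5 := (h1.mono (edgesWithin_le _)).dist_triangle_left z
  have h6 := (h2.symm.mono (edgesWithin_le _)).dist_triangle_left z
  rw [G.dist_comm (u := y) (v := (f i))] at h6
  exact ⟨f i, hcw, hfar i hi, by omega, by omega, by omega⟩

/-- Passing from `x` to `a` and then from `y` to `b` shortens the distance by one each time, and
`a`, `b` are still at distance at least 2. -/
theorem four_le_dist (hG : HasUniformAttachments G) (h : IsAttachedTriple G x y z a b c)
    (hab : ¬ G.Adj a b) : 4 ≤ G.dist x y := by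
  obtain ⟨-, -, -, hxy, hyz, hxz⟩ := h.triple
  have hay := h.fst_mem_farFrom hG
  have h1 := h.fst.dist hG (hyz.trans hyz.symm)
  have hp : HasPathMissing G z a y := hxz.symm.trans (.of_adj hxz.left hay h.fst.1)
  have h2 := h.snd.dist hG hp
  have hba : b ≠ a := by
    rintro rfl
    exact hay.2 h.snd.1
  have h3 := (h.snd.1.symm.reachable.trans (h.snd.congr hp).reachable).one_lt_dist_of_ne_of_not_adj
    hba (fun h => hab h.symm)
  rw [G.dist_comm (u := y) (v := a)] at h2
  omega

theorem fst_adj_of_dist (hG : HasUniformAttachments G) (h : IsAttachedTriple G x y z a b c) {w : V}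
    (hw : G.dist x w = 2) (hcw : G.Adj c w) : G.Adj a w ∧ ¬ G.Adj x w := by
  obtain ⟨-, -, -, hxy, hyz, hxz⟩ := h.triple
  have hcx := h.rotate.rotate.fst_mem_farFrom hG
  have hwx : w ∈ farFrom G x := by
    refine ⟨?_, fun h => ?_⟩
    · rintro rfl
      simp at hw
    · rw [dist_eq_one_iff_adj.2 h] at hw
      omega
  have := h.fst.dist hG (hyz.trans ((HasPathMissing.of_adj hyz.right hcx h.trd.1).trans
    (.of_adj hcx hwx hcw)))
  refine ⟨?_, hwx.2⟩
  rw [← dist_eq_one_iff_adj]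
  omega

end IsAttachedTriple

theorem IsObstructionFree.isATFree (hO : IsObstructionFree G) : IsATFree G := by
  have hG := hO.hasUniformAttachments
  have main : ∀ n x y z, IsAsteroidalTriple G x y z →
      G.dist x y + G.dist y z + G.dist x z = n → False := by
    intro n
    induction n using Nat.strong_induction_on with
    | _ n ih =>
    intro x y z hT hn
    have move : ∀ {x y z a b c : V}, IsAttachedTriple G x y z a b c →
        G.dist x y + G.dist y z + G.dist x z = n → ¬ HasPathMissing G x y c := by
      intro x y z a b c h hn hp
      obtain ⟨h1, h2, h3⟩ := h.replace_trd hG hp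
      exact ih _ (by omega) x y c h1 rfl
    have one : ∀ {x y z a b c : V}, IsAttachedTriple G x y z a b c →
        G.dist x y + G.dist y z + G.dist x z = n → G.Adj a b → G.Adj a c ∨ G.Adj b c := by
      intro x y z a b c h hn hab
      by_contra! hcon
      exact move h hn (h.hasPathMissing_trd_of_adj hG hab hcon.1 hcon.2)
    obtain ⟨-, -, -, hxy, hyz, hxz⟩ := id hT
    obtain ⟨a, ha, -⟩ := hxy.exists_isAttachment hyz.left
    obtain ⟨b, hb, -⟩ := hyz.exists_isAttachment hxz.right
    obtain ⟨c, hc, -⟩ := hxz.symm.exists_isAttachment hxy.left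
    have h : IsAttachedTriple G x y z a b c := ⟨hT, ha, hb, hc⟩
    have hn' : G.dist y z + G.dist z x + G.dist y x = n := by
      rw [G.dist_comm (u := z) (v := x), G.dist_comm (u := y) (v := x)]; omega
    have hn'' : G.dist z x + G.dist x y + G.dist z y = n := by
      rw [G.dist_comm (u := z) (v := x), G.dist_comm (u := z) (v := y)]; omega
    have hay := (h.fst_mem_farFrom hG).2
    have haz := (h.fst_mem_farFrom' hG).2
    have hbz := (h.rotate.fst_mem_farFrom hG).2
    have hbx := (h.rotate.fst_mem_farFrom' hG).2
    have hcx := (h.rotate.rotate.fst_mem_farFrom hG).2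
    have hcy := (h.rotate.rotate.fst_mem_farFrom' hG).2
    rw [G.adj_comm] at hay haz hbz hbx hcx hcy
    by_cases hall : G.Adj a b ∧ G.Adj b c ∧ G.Adj a c
    · exact hO.not_net hall.1 hall.2.2 hall.2.1 ha.1.symm hb.1.symm hc.1.symm hay haz hbx hbz hcx hcy
        hyz.left.2 hyz.right.2 hxz.right.2
    · have two : ¬ (G.Adj a b ∧ G.Adj b c) := fun h2 =>
        hall ⟨h2.1, h2.2, h.adj_of_two hG hO h2.1 h2.2⟩
      have two' : ¬ (G.Adj b c ∧ G.Adj a c) := fun h2 =>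
        hall ⟨(h.rotate.adj_of_two hG hO h2.1 h2.2.symm).symm, h2.1, h2.2⟩
      have two'' : ¬ (G.Adj a c ∧ G.Adj a b) := fun h2 =>
        hall ⟨h2.2, (h.rotate.rotate.adj_of_two hG hO h2.1.symm h2.2).symm, h2.1⟩
      have hab : ¬ G.Adj a b := fun h1 => by
        rcases one h hn h1 with h2 | h2
        · exact two'' ⟨h2, h1⟩
        · exact two ⟨h1, h2⟩
      have hbc : ¬ G.Adj b c := fun h1 => by
        rcases one h.rotate hn' h1 with h2 | h2
        · exact two ⟨h2.symm, h1⟩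
        · exact two' ⟨h1, h2.symm⟩
      have hac : ¬ G.Adj a c := fun h1 => by
        rcases one h.rotate.rotate hn'' h1.symm with h2 | h2
        · exact two' ⟨h2.symm, h1⟩
        · exact two'' ⟨h1, h2⟩
      have d1 := h.four_le_dist hG hab
      have d2 := h.rotate.four_le_dist hG hbc
      have d3 := h.rotate.rotate.four_le_dist hG (fun h => hac h.symm)
      obtain ⟨w, hcw, hwz, e1, e2, e3⟩ := h.exists_common hG (move h hn)
      obtain ⟨w', -, -, e1', e2', e3'⟩ := h.rotate.exists_common hG (move h.rotate hn')
      obtain ⟨w'', -, -, e1'', e2'', e3''⟩ :=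
        h.rotate.rotate.exists_common hG (move h.rotate.rotate hn'')
      have c1 := G.dist_comm (u := z) (v := x)
      have c2 := G.dist_comm (u := y) (v := x)
      have c3 := G.dist_comm (u := z) (v := y)
      -- The inequalities from `exists_common` say that the sum of any two of the three distances
      -- exceeds the third by at most 4. With all distances at least 4 they all equal 4, and `w` is
      -- at distance 2 from both `x` and `y`.
      obtain ⟨haw, hxw⟩ := h.fst_adj_of_dist hG (w := w) (by omega) hcw
      obtain ⟨hbw, hyw⟩ := h.swap.fst_adj_of_dist hG (w := w) (by rw [G.dist_comm]; omega) hcw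
      exact hO.not_subdivided_claw haw.symm hbw.symm hcw.symm (fun h => hxw h.symm)
        (fun h => hyw h.symm) (fun h => hwz.2 h.symm) hab hac hbc ha.1.symm hb.1.symm hc.1.symm
        hay haz hbx hbz hcx hcy hyz.left.2 hyz.right.2 hxz.right.2
  exact fun x y z h => main _ x y z h rfl

theorem IsObstructionFree.isDHATFree (hO : IsObstructionFree G) : IsDHATFree G :=
  ⟨hO.hasUniformAttachments.isDistanceHereditary, hO.isATFree⟩

end AsteroidalTriples

/-! ### Heredity, failure of the listed graphs, and their minimality. -/

section Minimality

variable {V W : Type*} {G : SimpleGraph V} {H : SimpleGraph W}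

theorem SimpleGraph.Reachable.dist_map_le {x y : W} (hr : H.Reachable x y) (f : H →g G) :
    G.dist (f x) (f y) ≤ H.dist x y := by
  obtain ⟨p, hp⟩ := hr.exists_walk_length_eq_dist
  calc G.dist (f x) (f y) ≤ (p.map f).length := dist_le _
    _ = H.dist x y := by rw [Walk.length_map, hp]

theorem IsATFree.of_embedding (hG : IsATFree G) (f : H ↪g G) : IsATFree H := by
  have key : ∀ x y z, HasPathMissing H x y z → HasPathMissing G (f x) (f y) (f z) := by
    rintro x y z ⟨p, hp, h⟩
    refine ⟨p.map f.toHom, hp.map f.injective, fun w hw => ?_⟩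
    rw [Walk.support_map, List.mem_map] at hw
    obtain ⟨w, hw, rfl⟩ := hw
    exact ⟨fun h' => (h w hw).1 (f.injective h'), fun h' => (h w hw).2 (f.map_adj_iff.1 h')⟩
  rintro x y z ⟨-, -, -, h1, h2, h3⟩
  exact hG _ _ _ (.of_paths (key _ _ _ h1) (key _ _ _ h2) (key _ _ _ h3))

/-- Distances only shrink from the induced subgraph to `H` and from `H` to `G`, and the two extremes
agree by the hypothesis on `G`. -/
theorem IsDistanceHereditary.of_embedding (hG : IsDistanceHereditary G) (f : H ↪g G) :
    IsDistanceHereditary H := by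
  intro S hS x y
  let g : H.induce S ↪g G := (Embedding.induce S).trans f
  let e := g.isoInduceRange
  have hr := hS.preconnected x y
  have hS' : (G.induce (Set.range g)).Connected := e.connected_iff.1 hS
  have h1 := hG _ hS' (e x) (e y)
  have h2 : (H.induce S).dist x y ≤ (G.induce (Set.range g)).dist (e x) (e y) := by
    have := (hS'.preconnected (e x) (e y)).dist_map_le e.symm.toHom
    simpa using this
  have h3 : G.dist (f x) (f y) ≤ H.dist x y :=
    (hr.map (Embedding.induce S).toHom).dist_map_le f.toHom
  have h4 : H.dist x y ≤ (H.induce S).dist x y := hr.dist_map_le (Embedding.induce S).toHom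
  have h5 : G.dist (e x : V) (e y) = G.dist (f x) (f y) := rfl
  omega

theorem IsDHATFree.of_embedding (hG : IsDHATFree G) (f : H ↪g G) : IsDHATFree H :=
  ⟨hG.1.of_embedding f, hG.2.of_embedding f⟩

/-- A path whose non-adjacent ends have a common neighbour, but none on the path, witnesses that
the graph is not distance-hereditary. -/
theorem not_isDistanceHereditary_of_path {f : ℕ → V} {m : ℕ} {e : V}
    (hadj : ∀ i < m, G.Adj (f i) (f (i + 1))) (h0 : G.Adj e (f 0)) (hm : G.Adj e (f m))
    (hne : f 0 ≠ f m) (hnadj : ¬ G.Adj (f 0) (f m))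
    (hcommon : ∀ i < m + 1, ¬ (G.Adj (f 0) (f i) ∧ G.Adj (f i) (f m))) :
    ¬ IsDistanceHereditary G := by
  intro hG
  let S : Set V := f '' Set.Iic m
  have hmem : ∀ i ≤ m, f i ∈ S := fun i hi => ⟨i, hi, rfl⟩
  let x : S := ⟨f 0, hmem 0 (Nat.zero_le _)⟩
  let y : S := ⟨f m, hmem m le_rfl⟩
  have hreach : ∀ i (hi : i ≤ m), (G.induce S).Reachable x ⟨f i, hmem i hi⟩ := by
    intro i
    induction i with
    | zero => intro _; exact Reachable.refl _
    | succ i ih =>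
      intro hi
      have : (G.induce S).Adj ⟨f i, hmem i (by omega)⟩ ⟨f (i + 1), hmem _ hi⟩ := hadj i (by omega)
      exact (ih (by omega)).trans this.reachable
  have hconn : (G.induce S).Connected := by
    have : Nonempty S := ⟨x⟩
    refine ⟨?_⟩
    rintro ⟨_, i, hi, rfl⟩ ⟨_, j, hj, rfl⟩
    exact (hreach i hi).symm.trans (hreach j hj)
  have hd := hG S hconn x y
  have h1 : G.dist (f 0) (f m) ≤ 2 := by
    have := h0.symm.reachable.dist_triangle_left (f m)
    rwa [dist_eq_one_iff_adj.2 h0.symm, dist_eq_one_iff_adj.2 hm] at this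
  have hr := hconn.preconnected x y
  have h2 := hr.one_lt_dist_of_ne_of_not_adj (fun h => hne (congrArg Subtype.val h)) hnadj
  have h3 : (G.induce S).dist x y = 2 := by
    have : (G.induce S).dist x y ≤ 2 := hd ▸ h1
    omega
  -- Distance-heredity keeps the distance 2 inside the path, so the middle vertex of a geodesic
  -- there is a forbidden common neighbour.
  obtain ⟨g, hg0, hg2, hgadj, -⟩ := hr.exists_geodesic
  rw [h3] at hg2 hgadj
  have e1 := hgadj 0 (by omega)
  have e2 := hgadj 1 (by omega)
  rw [hg0] at e1
  rw [hg2] at e2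
  obtain ⟨i, hi, hgi⟩ := (g 1).2
  refine hcommon i (Nat.lt_succ_of_le hi) ⟨?_, ?_⟩
  · rw [hgi]; exact e1
  · rw [hgi]; exact e2

theorem hasPathMissing_of_seq (f : ℕ → V) (m : ℕ) (x : V)
    (hadj : ∀ i < m, G.Adj (f i) (f (i + 1))) (hf : ∀ i < m + 1, f i ≠ x ∧ ¬ G.Adj x (f i)) :
    HasPathMissing G (f 0) (f m) x :=
  hasPathMissing_of_chain (Nat.zero_le _) (fun i _ hi => hadj i hi)
    (fun i _ hi => hf i (Nat.lt_succ_of_le hi))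

theorem not_isDistanceHereditary_cycleGraph {n : ℕ} (hn : 5 ≤ n) :
    ¬ IsDistanceHereditary (cycleGraph n) := by
  obtain ⟨n, rfl⟩ := Nat.exists_eq_add_of_le' hn
  -- The path runs through every vertex but 0, which is the common neighbour of its ends; the
  -- default value lies beyond the indices used.
  let f : ℕ → Fin (n + 3 + 2) := fun i => if h : i + 1 < n + 5 then ⟨i + 1, h⟩ else 0
  have hf : ∀ i (h : i + 1 < n + 5), f i = ⟨i + 1, h⟩ := fun i h => dif_pos h
  have hlt : ∀ i j, i < j → (h : j + 1 < n + 5) →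
      ((cycleGraph (n + 5)).Adj (f i) (f j) ↔ i + 1 = j) := by
    intro i j hij hj
    rw [hf i (by omega), hf j hj, cycleGraph_adj_of_lt (by simp only; omega)]
    simp only
    omega
  have hzero : ∀ i (h : i + 1 < n + 5),
      ((cycleGraph (n + 5)).Adj 0 (f i) ↔ i = 0 ∨ i = n + 3) := by
    intro i h
    rw [hf i h, cycleGraph_adj_of_lt (by simp)]
    simp only [Fin.val_zero, true_and]
    omega
  refine not_isDistanceHereditary_of_path (f := f) (m := n + 3) (e := 0) ?_ ?_ ?_ ?_ ?_ ?_
  · intro i hi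
    exact (hlt i (i + 1) (by omega) (by omega)).2 rfl
  · exact (hzero 0 (by omega)).2 (Or.inl rfl)
  · exact (hzero _ (by omega)).2 (Or.inr rfl)
  · rw [hf 0 (by omega), hf (n + 3) (by omega)]
    simp
  · rw [hlt 0 (n + 3) (by omega) (by omega)]
    omega
  · rintro i hi ⟨h1, h2⟩
    rcases Nat.eq_zero_or_pos i with rfl | hi0
    · exact h1.ne rfl
    · rcases Nat.lt_or_ge i (n + 3) with hi' | hi'
      · rw [hlt 0 i hi0 (by omega)] at h1
        rw [hlt i _ hi' (by omega)] at h2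
        omega
      · obtain rfl : i = n + 3 := by omega
        exact h2.ne rfl

theorem not_isDistanceHereditary_houseGraph : ¬ IsDistanceHereditary houseGraph := by
  unfold houseGraph
  exact not_isDistanceHereditary_of_path (f := fun i => [4, 1, 2, 3].getD i 0) (m := 3) (e := 0)
    (by decide) (by decide) (by decide) (by decide) (by decide) (by decide)

theorem not_isDistanceHereditary_gemGraph : ¬ IsDistanceHereditary gemGraph := by
  unfold gemGraph
  exact not_isDistanceHereditary_of_path (f := fun i => [0, 1, 2, 3].getD i 0) (m := 3) (e := 4)
    (by decide) (by decide) (by decide) (by decide) (by decide) (by decide)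

theorem not_isDistanceHereditary_dominoGraph : ¬ IsDistanceHereditary dominoGraph := by
  unfold dominoGraph
  exact not_isDistanceHereditary_of_path (f := fun i => [2, 1, 0, 5, 4].getD i 0) (m := 4) (e := 3)
    (by decide) (by decide) (by decide) (by decide) (by decide) (by decide)

theorem not_isATFree_graphA1 : ¬ IsATFree graphA1 := by
  unfold graphA1
  exact fun h => h 4 5 6 (.of_paths
    (hasPathMissing_of_seq (fun i => [4, 1, 0, 2, 5].getD i 0) 4 _ (by decide) (by decide))
    (hasPathMissing_of_seq (fun i => [5, 2, 0, 3, 6].getD i 0) 4 _ (by decide) (by decide))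
    (hasPathMissing_of_seq (fun i => [4, 1, 0, 3, 6].getD i 0) 4 _ (by decide) (by decide)))

theorem not_isATFree_graphA22 : ¬ IsATFree graphA22 := by
  unfold graphA22
  exact fun h => h 3 4 5 (.of_paths
    (hasPathMissing_of_seq (fun i => [3, 0, 1, 4].getD i 0) 3 _ (by decide) (by decide))
    (hasPathMissing_of_seq (fun i => [4, 1, 2, 5].getD i 0) 3 _ (by decide) (by decide))
    (hasPathMissing_of_seq (fun i => [3, 0, 2, 5].getD i 0) 3 _ (by decide) (by decide)))

theorem not_isATFree_graphA3 : ¬ IsATFree graphA3 := by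
  unfold graphA3
  exact fun h => h 4 5 6 (.of_paths
    (hasPathMissing_of_seq (fun i => [4, 0, 1, 5].getD i 0) 3 _ (by decide) (by decide))
    (hasPathMissing_of_seq (fun i => [5, 1, 2, 6].getD i 0) 3 _ (by decide) (by decide))
    (hasPathMissing_of_seq (fun i => [4, 0, 3, 2, 6].getD i 0) 4 _ (by decide) (by decide)))

theorem not_isATFree_graphA23 : ¬ IsATFree graphA23 := by
  unfold graphA23
  exact fun h => h 4 5 6 (.of_paths
    (hasPathMissing_of_seq (fun i => [4, 0, 1, 2, 5].getD i 0) 4 _ (by decide) (by decide))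
    (hasPathMissing_of_seq (fun i => [5, 2, 3, 6].getD i 0) 3 _ (by decide) (by decide))
    (hasPathMissing_of_seq (fun i => [4, 0, 3, 6].getD i 0) 3 _ (by decide) (by decide)))

theorem IsListedObstruction.not_isDHATFree (hG : IsListedObstruction G) : ¬ IsDHATFree G := by
  intro h
  rcases hG with ⟨n, hn, ⟨e⟩⟩ | ⟨⟨e⟩⟩ | ⟨⟨e⟩⟩ | ⟨⟨e⟩⟩ | ⟨⟨e⟩⟩ | ⟨⟨e⟩⟩ | ⟨⟨e⟩⟩ | ⟨⟨e⟩⟩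
  · exact not_isDistanceHereditary_cycleGraph hn (h.1.of_embedding e.symm.toEmbedding)
  · exact not_isDistanceHereditary_dominoGraph (h.1.of_embedding e.symm.toEmbedding)
  · exact not_isDistanceHereditary_houseGraph (h.1.of_embedding e.symm.toEmbedding)
  · exact not_isDistanceHereditary_gemGraph (h.1.of_embedding e.symm.toEmbedding)
  · exact not_isATFree_graphA1 (h.2.of_embedding e.symm.toEmbedding)
  · exact not_isATFree_graphA22 (h.2.of_embedding e.symm.toEmbedding)
  · exact not_isATFree_graphA3 (h.2.of_embedding e.symm.toEmbedding)
  · exact not_isATFree_graphA23 (h.2.of_embedding e.symm.toEmbedding)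

theorem isDHATFree_iff_isObstructionFree : IsDHATFree G ↔ IsObstructionFree G :=
  ⟨fun h S hS => hS.not_isDHATFree (h.of_embedding (Embedding.induce S)), fun h => h.isDHATFree⟩

/-- Some induced path on four vertices has ends with a common neighbour. -/
def HasShortcutFour (G : SimpleGraph V) : Prop :=
  ∃ a b, G.Adj a b ∧ ∃ c, G.Adj b c ∧ ¬ G.Adj a c ∧ ∃ d, G.Adj c d ∧ ¬ G.Adj a d ∧ ¬ G.Adj b d ∧
    ∃ e, G.Adj e a ∧ G.Adj e d

/-- Some induced path on five vertices has ends with a common neighbour. -/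
def HasShortcutFive (G : SimpleGraph V) : Prop :=
  ∃ a b, G.Adj a b ∧ ∃ c, G.Adj b c ∧ ¬ G.Adj a c ∧ ∃ d, G.Adj c d ∧ ¬ G.Adj a d ∧ ¬ G.Adj b d ∧
    ∃ f, G.Adj d f ∧ ¬ G.Adj a f ∧ ¬ G.Adj b f ∧ ¬ G.Adj c f ∧ ∃ e, G.Adj e a ∧ G.Adj e f

/-- Some triangle has private neighbours at each of its vertices. -/
def HasPrivateTriangle (G : SimpleGraph V) : Prop :=
  ∃ a b, G.Adj a b ∧ ∃ c, G.Adj a c ∧ G.Adj b c ∧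
    (∃ x, G.Adj a x ∧ ¬ G.Adj b x ∧ ¬ G.Adj c x) ∧ (∃ y, G.Adj b y ∧ ¬ G.Adj a y ∧ ¬ G.Adj c y) ∧
    ∃ z, G.Adj c z ∧ ¬ G.Adj a z ∧ ¬ G.Adj b z

/-- Some vertex has three distinct neighbours. -/
def HasThreeNeighbours (G : SimpleGraph V) : Prop :=
  ∃ v a, G.Adj v a ∧ ∃ b, G.Adj v b ∧ a ≠ b ∧ ∃ c, G.Adj v c ∧ a ≠ c ∧ b ≠ c

theorem HasShortcutFour.map (h : HasShortcutFour H) (f : H ↪g G) : HasShortcutFour G := by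
  obtain ⟨a, b, h1, c, h2, h3, d, h4, h5, h6, e, h7, h8⟩ := h
  exact ⟨f a, f b, by simpa using h1, f c, by simpa using h2, by simpa using h3, f d,
    by simpa using h4, by simpa using h5, by simpa using h6, f e, by simpa using h7,
    by simpa using h8⟩

theorem HasShortcutFive.map (h : HasShortcutFive H) (f : H ↪g G) : HasShortcutFive G := by
  obtain ⟨a, b, h1, c, h2, h3, d, h4, h5, h6, g, h9, h10, h11, h12, e, h7, h8⟩ := h
  exact ⟨f a, f b, by simpa using h1, f c, by simpa using h2, by simpa using h3, f d,
    by simpa using h4, by simpa using h5, by simpa using h6, f g, by simpa using h9,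
    by simpa using h10, by simpa using h11, by simpa using h12, f e, by simpa using h7,
    by simpa using h8⟩

theorem HasPrivateTriangle.map (h : HasPrivateTriangle H) (f : H ↪g G) : HasPrivateTriangle G := by
  obtain ⟨a, b, h1, c, h2, h3, ⟨x, hx⟩, ⟨y, hy⟩, z, hz⟩ := h
  exact ⟨f a, f b, by simpa using h1, f c, by simpa using h2, by simpa using h3,
    ⟨f x, by simpa using hx⟩, ⟨f y, by simpa using hy⟩, f z, by simpa using hz⟩

theorem HasThreeNeighbours.map (h : HasThreeNeighbours H) (f : H ↪g G) : HasThreeNeighbours G := by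
  obtain ⟨v, a, h1, b, h2, h3, c, h4, h5, h6⟩ := h
  exact ⟨f v, f a, by simpa using h1, f b, by simpa using h2, by simpa using h3, f c,
    by simpa using h4, by simpa using h5, by simpa using h6⟩

theorem not_hasThreeNeighbours_cycleGraph {n : ℕ} (hn : 2 ≤ n) :
    ¬ HasThreeNeighbours (cycleGraph n) := by
  obtain ⟨n, rfl⟩ := Nat.exists_eq_add_of_le' hn
  rintro ⟨v, a, ha, b, hb, hab, c, hc, hac, hbc⟩
  rw [← mem_neighborSet, cycleGraph_neighborSet] at ha hb hc
  simp only [Set.mem_insert_iff, Set.mem_singleton_iff] at ha hb hc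
  rcases ha with rfl | rfl <;> rcases hb with rfl | rfl <;> rcases hc with rfl | rfl <;>
    simp_all

/-- By connectedness an edge would leave a proper image, giving its end in the image a third
neighbour besides the two from the smaller cycle. These two differ because `k` is at least 3. -/
theorem surjective_of_embedding_cycleGraph {k n : ℕ} (hk : 3 ≤ k) (hn : 2 ≤ n)
    (f : cycleGraph k ↪g cycleGraph n) : Function.Surjective f := by
  obtain ⟨k, rfl⟩ := Nat.exists_eq_add_of_le' hk
  obtain ⟨n, rfl⟩ := Nat.exists_eq_add_of_le' hn
  intro y
  by_contra hy
  obtain ⟨_, ⟨v, rfl⟩, d, hd, -, hadj⟩ :=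
    (cycleGraph_preconnected (f 0) y).exists_exit (S := Set.range f) ⟨0, rfl⟩ hy
  have hs : cycleGraph (k + 3) = cycleGraph (k + 1 + 2) := rfl
  refine not_hasThreeNeighbours_cycleGraph (by omega) ⟨f v, d, hadj, f (v + 1), ?_, ?_, f (v - 1),
    ?_, ?_, ?_⟩
  · rw [f.map_adj_iff, hs, ← mem_neighborSet, cycleGraph_neighborSet]
    simp
  · rintro rfl; exact hd ⟨_, rfl⟩
  · rw [f.map_adj_iff, hs, ← mem_neighborSet, cycleGraph_neighborSet]
    simp
  · rintro rfl; exact hd ⟨_, rfl⟩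
  · intro h
    have h := f.injective h
    have h2 : (1 : Fin (k + 3)) + 1 = 0 := by
      have : v + 1 + 1 = v - 1 + 1 := by rw [h]
      rw [sub_add_cancel, add_assoc] at this
      simpa using this
    have := congrArg Fin.val h2
    rw [Fin.val_add] at this
    simp [Nat.mod_eq_of_lt (show 2 < k + 3 by omega)] at this

theorem surjective_of_card_le {k m : ℕ} {K : SimpleGraph (Fin k)} {L : SimpleGraph (Fin m)}
    (h : m ≤ k) (f : K ↪g L) : Function.Surjective f :=
  (f.injective.bijective_of_nat_card_le (by simpa using h)).2

/-- A source with at least `m` vertices embeds onto `L` by counting. Smaller sources have 5 or 6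
vertices, and each contains a pattern that embeddings preserve: the shortcuts cover the two short
holes, house, gem and domino, the private triangle covers the net. -/
theorem surjective_of_not_patterns {m : ℕ} (hm : m ≤ 7) {L : SimpleGraph (Fin m)}
    (h4 : m ≤ 5 ∨ ¬ HasShortcutFour L) (h5 : m ≤ 6 ∨ ¬ HasShortcutFive L)
    (h6 : m ≤ 6 ∨ ¬ HasPrivateTriangle L) {K : SimpleGraph W} (hK : IsListedObstruction K)
    (f : K ↪g L) : Function.Surjective f := by
  have tr : ∀ {k : ℕ} {K' : SimpleGraph (Fin k)} (e : K ≃g K'),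
      Function.Surjective (f.comp e.symm.toEmbedding) → Function.Surjective f := by
    intro k K' e h y
    obtain ⟨x, hx⟩ := h y
    exact ⟨_, hx⟩
  have four : ∀ {K' : SimpleGraph (Fin 5)} (e : K ≃g K'), HasShortcutFour K' →
      Function.Surjective f := fun e h => h4.elim
    (fun h => tr e (surjective_of_card_le h _))
    (fun h' => absurd (h.map (f.comp e.symm.toEmbedding)) h')
  have five : ∀ {K' : SimpleGraph (Fin 6)} (e : K ≃g K'), HasShortcutFive K' →
      Function.Surjective f := fun e h => h5.elim
    (fun h => tr e (surjective_of_card_le h _))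
    (fun h' => absurd (h.map (f.comp e.symm.toEmbedding)) h')
  have net : ∀ {K' : SimpleGraph (Fin 6)} (e : K ≃g K'), HasPrivateTriangle K' →
      Function.Surjective f := fun e h => h6.elim
    (fun h => tr e (surjective_of_card_le h _))
    (fun h' => absurd (h.map (f.comp e.symm.toEmbedding)) h')
  rcases hK with ⟨n, hn, ⟨e⟩⟩ | ⟨⟨e⟩⟩ | ⟨⟨e⟩⟩ | ⟨⟨e⟩⟩ | ⟨⟨e⟩⟩ | ⟨⟨e⟩⟩ | ⟨⟨e⟩⟩ | ⟨⟨e⟩⟩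
  · obtain rfl | rfl | hn : n = 5 ∨ n = 6 ∨ 7 ≤ n := by omega
    · exact four e (by unfold HasShortcutFour; decide)
    · exact five e (by unfold HasShortcutFive; decide)
    · exact tr e (surjective_of_card_le (by omega) _)
  · exact five e (by unfold HasShortcutFive dominoGraph; decide)
  · exact four e (by unfold HasShortcutFour houseGraph; decide)
  · exact four e (by unfold HasShortcutFour gemGraph; decide)
  · exact tr e (surjective_of_card_le hm _)
  · exact net e (by unfold HasPrivateTriangle graphA22; decide)
  · exact tr e (surjective_of_card_le hm _)
  · exact tr e (surjective_of_card_le hm _)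

/-- In a cycle no vertex has three neighbours, which leaves only holes as sources; the other targets
have at most 7 vertices and are settled by the patterns. -/
theorem IsListedObstruction.surjective_of_embedding (hG : IsListedObstruction G)
    (hH : IsListedObstruction H) (f : H ↪g G) : Function.Surjective f := by
  have tr : ∀ {k : ℕ} {L : SimpleGraph (Fin k)} (e : G ≃g L),
      Function.Surjective (e.toEmbedding.comp f) → Function.Surjective f := by
    intro k L e h y
    obtain ⟨x, hx⟩ := h (e y)
    exact ⟨x, e.injective hx⟩
  rcases hG with ⟨n, hn, ⟨e⟩⟩ | ⟨⟨e⟩⟩ | ⟨⟨e⟩⟩ | ⟨⟨e⟩⟩ | ⟨⟨e⟩⟩ | ⟨⟨e⟩⟩ | ⟨⟨e⟩⟩ | ⟨⟨e⟩⟩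
  · have three : ∀ {k : ℕ} {K : SimpleGraph (Fin k)} (_ : H ≃g K), HasThreeNeighbours K →
        Function.Surjective f := fun e' h =>
      absurd (h.map ((e.toEmbedding.comp f).comp e'.symm.toEmbedding))
        (not_hasThreeNeighbours_cycleGraph (by omega))
    rcases hH with ⟨k, hk, ⟨e'⟩⟩ | ⟨⟨e'⟩⟩ | ⟨⟨e'⟩⟩ | ⟨⟨e'⟩⟩ | ⟨⟨e'⟩⟩ | ⟨⟨e'⟩⟩ | ⟨⟨e'⟩⟩ | ⟨⟨e'⟩⟩
    · refine tr e fun y => ?_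
      obtain ⟨x, hx⟩ := surjective_of_embedding_cycleGraph (by omega) (by omega)
        ((e.toEmbedding.comp f).comp e'.symm.toEmbedding) y
      exact ⟨_, hx⟩
    · exact three e' (by unfold HasThreeNeighbours dominoGraph; decide)
    · exact three e' (by unfold HasThreeNeighbours houseGraph; decide)
    · exact three e' (by unfold HasThreeNeighbours gemGraph; decide)
    · exact three e' (by unfold HasThreeNeighbours graphA1; decide)
    · exact three e' (by unfold HasThreeNeighbours graphA22; decide)
    · exact three e' (by unfold HasThreeNeighbours graphA3; decide)
    · exact three e' (by unfold HasThreeNeighbours graphA23; decide)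
  · exact tr e (surjective_of_not_patterns (by omega)
      (Or.inr (by unfold HasShortcutFour dominoGraph; decide +kernel)) (Or.inl le_rfl)
      (Or.inl le_rfl) hH _)
  · exact tr e (surjective_of_not_patterns (by omega) (Or.inl le_rfl) (Or.inl (by omega))
      (Or.inl (by omega)) hH _)
  · exact tr e (surjective_of_not_patterns (by omega) (Or.inl le_rfl) (Or.inl (by omega))
      (Or.inl (by omega)) hH _)
  · exact tr e (surjective_of_not_patterns (by omega)
      (Or.inr (by unfold HasShortcutFour graphA1; decide +kernel))
      (Or.inr (by unfold HasShortcutFive graphA1; decide +kernel))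
      (Or.inr (by unfold HasPrivateTriangle graphA1; decide +kernel)) hH _)
  · exact tr e (surjective_of_not_patterns (by omega)
      (Or.inr (by unfold HasShortcutFour graphA22; decide +kernel)) (Or.inl le_rfl)
      (Or.inl le_rfl) hH _)
  · exact tr e (surjective_of_not_patterns (by omega)
      (Or.inr (by unfold HasShortcutFour graphA3; decide +kernel))
      (Or.inr (by unfold HasShortcutFive graphA3; decide +kernel))
      (Or.inr (by unfold HasPrivateTriangle graphA3; decide +kernel)) hH _)
  · exact tr e (surjective_of_not_patterns (by omega)
      (Or.inr (by unfold HasShortcutFour graphA23; decide +kernel))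
      (Or.inr (by unfold HasShortcutFive graphA23; decide +kernel))
      (Or.inr (by unfold HasPrivateTriangle graphA23; decide +kernel)) hH _)

theorem minimal_not_isDHATFree_iff :
    (¬ IsDHATFree G ∧ ∀ S : Set V, S ≠ Set.univ → IsDHATFree (G.induce S)) ↔
      IsListedObstruction G := by
  constructor
  · rintro ⟨h1, h2⟩
    rw [isDHATFree_iff_isObstructionFree, IsObstructionFree] at h1
    push Not at h1
    obtain ⟨S, hS⟩ := h1
    obtain rfl : S = Set.univ := by
      by_contra hne
      exact hS.not_isDHATFree (h2 S hne)
    exact hS.of_iso (induceUnivIso G).symm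
  · refine fun h => ⟨h.not_isDHATFree, fun S hS => ?_⟩
    rw [isDHATFree_iff_isObstructionFree]
    intro T hT
    have := h.surjective_of_embedding hT
      ((Embedding.induce S).comp (Embedding.induce (G := G.induce S) T))
    refine hS (Set.eq_univ_of_forall fun v => ?_)
    obtain ⟨x, rfl⟩ := this v
    exact x.1.2

end Minimality

/-! ### Caterpillars and the branches of a tree. -/

section Trees

variable {N : Type*} {T : SimpleGraph N}

theorem SimpleGraph.Walk.IsPath.exists_nonleaf_second_vertex {a b : N} {p : T.Walk a b} (hp : p.IsPath)
    (hl : 2 ≤ p.length) : ∃ y, T.Adj a y ∧ y ∈ p.support.tail ∧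
      ¬ (T.neighborSet y).Subsingleton := by
  cases p with
  | nil => simp at hl
  | @cons _ y _ h p =>
    cases p with
    | nil => simp at hl
    | @cons _ z _ h' p =>
      refine ⟨y, h, by simp, fun hs => ?_⟩
      have : a = z := hs h.symm h'
      subst this
      simp at hp

theorem exists_longest_path [Finite N] [Nonempty N] (T : SimpleGraph N) :
    ∃ (a b : N) (p : T.Walk a b), p.IsPath ∧
      ∀ (c d : N) (q : T.Walk c d), q.IsPath → q.length ≤ p.length := by
  classical
  have := Fintype.ofFinite N
  let S : Set ℕ := {n | ∃ (a b : N) (p : T.Walk a b), p.IsPath ∧ p.length = n}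
  obtain ⟨a⟩ := ‹Nonempty N›
  have hne : S.Nonempty := ⟨0, a, a, Walk.nil, Walk.IsPath.nil, rfl⟩
  have hb : BddAbove S := by
    refine ⟨Fintype.card N, ?_⟩
    rintro n ⟨a, b, p, hp, rfl⟩
    exact hp.length_lt.le
  obtain ⟨a, b, p, hp, hl⟩ := Nat.sSup_mem hne hb
  exact ⟨a, b, p, hp, fun c d q hq => hl ▸ le_csSup hb ⟨c, d, q, hq, rfl⟩⟩

/-- Take a longest path. A node `d` at distance 2 from it, attached through `c` to a path vertex
`x`, would give `x` three non-leaf neighbours: `c` and its two neighbours on the path. -/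
theorem SimpleGraph.IsTree.isCaterpillar [Finite N] (hT : T.IsTree)
    (h : ∀ v u₁ u₂ u₃, T.Adj v u₁ → T.Adj v u₂ → T.Adj v u₃ → u₁ ≠ u₂ → u₁ ≠ u₃ → u₂ ≠ u₃ →
      ¬ (T.neighborSet u₁).Subsingleton → ¬ (T.neighborSet u₂).Subsingleton →
      (T.neighborSet u₃).Subsingleton) : IsCaterpillar T := by
  classical
  have := hT.connected.nonempty
  obtain ⟨a, b, p, hp, hmax⟩ := exists_longest_path T
  refine ⟨hT, a, b, p, hp, fun w => ?_⟩
  by_contra hw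
  obtain ⟨c, hc, d, hd, -, hcd⟩ := (hT.connected.preconnected a w).exists_exit
    (S := {n | n ∈ p.support ∨ ∃ x ∈ p.support, T.Adj x n}) (Or.inl p.start_mem_support) hw
  have hcp : c ∉ p.support := fun hcp => hd (Or.inr ⟨c, hcp, hcd⟩)
  have hdp : d ∉ p.support := fun hdp => hd (Or.inl hdp)
  obtain ⟨x, hx, hxc⟩ := hc.resolve_left hcp
  -- Each part of `p` at `x`, extended by `c` and `d`, is no longer than `p`; hence the opposite
  -- part has length at least 2.
  have long : ∀ {e : N} (q : T.Walk x e), q.IsPath → (∀ y ∈ q.support, y ∈ p.support) →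
      q.length + 2 ≤ p.length := by
    intro e q hq hsub
    refine hmax d e (.cons hcd.symm (.cons hxc.symm q)) ?_
    rw [Walk.cons_isPath_iff, Walk.cons_isPath_iff, Walk.support_cons, List.mem_cons, not_or]
    exact ⟨⟨hq, fun h => hcp (hsub _ h)⟩, hcd.ne.symm, fun h => hdp (hsub _ h)⟩
  have hspec := p.take_spec hx
  have hlen := congrArg Walk.length hspec
  rw [Walk.length_append] at hlen
  have l1 := long (p.dropUntil x hx) (hp.dropUntil hx)
    (fun y hy => p.support_dropUntil_subset_support hx hy)
  have l2 := long (p.takeUntil x hx).reverse (hp.takeUntil hx).reverse (fun y hy => by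
    rw [Walk.support_reverse, List.mem_reverse] at hy
    exact p.support_takeUntil_subset_support hx hy)
  rw [Walk.length_reverse] at l2
  obtain ⟨y, hxy, hy, hy'⟩ := (hp.dropUntil hx).exists_nonleaf_second_vertex (by omega)
  obtain ⟨z, hxz, hz, hz'⟩ := (hp.takeUntil hx).reverse.exists_nonleaf_second_vertex
    (by rw [Walk.length_reverse]; omega)
  have hz := List.mem_of_mem_tail hz
  rw [Walk.support_reverse, List.mem_reverse] at hz
  have hyz : y ≠ z := by
    rintro rfl
    have hnd := hp.support_nodup
    rw [← hspec, Walk.support_append] at hnd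
    exact (List.nodup_append.1 hnd).2.2 _ hz _ hy rfl
  refine absurd (h x y z c hxy hxz hxc hyz ?_ ?_ hy' hz') fun hs => hxc.ne ?_
  · rintro rfl
    exact hcp (p.support_dropUntil_subset_support hx (List.mem_of_mem_tail hy))
  · rintro rfl
    exact hcp (p.support_takeUntil_subset_support hx hz)
  · have : x = d := hs hxc.symm hcd
    exact absurd hx (this ▸ hdp)

/-- `n` lies in the component of `T - v` containing `u`. -/
def IsBeyond (T : SimpleGraph N) (v u n : N) : Prop :=
  ∃ p : T.Walk u n, p.IsPath ∧ v ∉ p.support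

theorem SimpleGraph.IsAcyclic.eq_of_isPath (hT : T.IsAcyclic) {v w : N} {p q : T.Walk v w}
    (hp : p.IsPath) (hq : q.IsPath) : p = q :=
  congrArg Subtype.val ((hT.subsingleton_path v w).elim ⟨p, hp⟩ ⟨q, hq⟩)

theorem IsBeyond.refl {v u : N} (h : v ≠ u) : IsBeyond T v u u :=
  ⟨.nil, .nil, by simpa using h⟩

theorem IsBeyond.ne {v u n : N} (h : IsBeyond T v u n) : n ≠ v := by
  obtain ⟨p, -, hv⟩ := h
  rintro rfl
  exact hv p.end_mem_support

theorem IsBeyond.of_mem_support {v u n w : N} {p : T.Walk u n} (hp : p.IsPath)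
    (hv : v ∉ p.support) (hw : w ∈ p.support) : IsBeyond T v u w := by
  classical
  exact ⟨p.takeUntil w hw, hp.takeUntil hw,
    fun h => hv (p.support_takeUntil_subset_support hw h)⟩

theorem IsBeyond.not_symm (hT : T.IsAcyclic) {v u n : N} (hvu : T.Adj v u)
    (h : IsBeyond T v u n) : ¬ IsBeyond T u v n := by
  rintro ⟨q, hq, hu⟩
  obtain ⟨p, hp, hv⟩ := h
  have := hT.eq_of_isPath hq (hp.cons hv : (Walk.cons hvu p).IsPath)
  exact hu (by simp [this])

theorem IsBeyond.eq (hT : T.IsAcyclic) {v u u' n : N} (hu : T.Adj v u) (hu' : T.Adj v u')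
    (h : IsBeyond T v u n) (h' : IsBeyond T v u' n) : u = u' := by
  obtain ⟨p, hp, hv⟩ := h
  obtain ⟨p', hp', hv'⟩ := h'
  have := hT.eq_of_isPath (hp.cons hv : (Walk.cons hu p).IsPath)
    (hp'.cons hv' : (Walk.cons hu' p').IsPath)
  have := congrArg Walk.snd this
  simpa using this

theorem isBeyond_of_not (hT : T.IsTree) {v u n : N} (hvu : T.Adj v u) (h : ¬ IsBeyond T v u n) :
    IsBeyond T u v n := by
  classical
  obtain ⟨q, hq, -⟩ := hT.existsUnique_path v n
  refine ⟨q, hq, fun hu => h ⟨q.dropUntil u hu, hq.dropUntil hu, fun hv => ?_⟩⟩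
  have hnd := hq.support_nodup
  rw [← q.take_spec hu, Walk.support_append] at hnd
  rw [← Walk.cons_tail_support, List.mem_cons] at hv
  exact (List.nodup_append.1 hnd).2.2 _ (Walk.start_mem_support _) _
    (hv.resolve_left hvu.ne) rfl

theorem IsBeyond.not_mem_support (hT : T.IsAcyclic) {v u w n : N} (hvu : T.Adj v u)
    (huw : T.Adj u w) (hwv : w ≠ v) {p : T.Walk w n} (hp : p.IsPath) (hu : u ∉ p.support) :
    v ∉ p.support := fun hv =>
  hwv (IsBeyond.eq hT huw hvu.symm (.of_mem_support hp hu hv) (.refl hvu.ne.symm))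

theorem IsBeyond.trans (hT : T.IsAcyclic) {v u w n : N} (hvu : T.Adj v u) (huw : T.Adj u w)
    (hwv : w ≠ v) (h : IsBeyond T u w n) : IsBeyond T v u n := by
  obtain ⟨p, hp, hu⟩ := h
  refine ⟨.cons huw p, hp.cons hu, ?_⟩
  rw [Walk.support_cons, List.mem_cons, not_or]
  exact ⟨hvu.ne, IsBeyond.not_mem_support hT hvu huw hwv hp hu⟩

/-- Walk away from `v`: each move into a further branch strictly shrinks the set of nodes beyond. -/
theorem exists_leaf_isBeyond [Finite N] (hT : T.IsAcyclic) {v u : N} (hvu : T.Adj v u) :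
    ∃ l, (T.neighborSet l).Subsingleton ∧ IsBeyond T v u l := by
  have main : ∀ n v u, T.Adj v u → {m | IsBeyond T v u m}.ncard = n →
      ∃ l, (T.neighborSet l).Subsingleton ∧ IsBeyond T v u l := by
    intro n
    induction n using Nat.strong_induction_on with
    | _ n ih =>
    intro v u hvu hn
    by_cases hs : (T.neighborSet u).Subsingleton
    · exact ⟨u, hs, .refl hvu.ne⟩
    · have : ∃ w, T.Adj u w ∧ w ≠ v := by
        by_contra! hcon
        exact hs fun a ha b hb => (hcon a ha).trans (hcon b hb).symm
      obtain ⟨w, huw, hwv⟩ := this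
      have hlt : {m | IsBeyond T u w m}.ncard < {m | IsBeyond T v u m}.ncard := by
        refine Set.ncard_lt_ncard ⟨fun m hm => IsBeyond.trans hT hvu huw hwv hm, fun hsub => ?_⟩
          (Set.toFinite _)
        exact IsBeyond.ne (hsub (IsBeyond.refl hvu.ne : IsBeyond T v u u)) rfl
      obtain ⟨l, hl, hl'⟩ := ih _ (hn ▸ hlt) u w huw rfl
      exact ⟨l, hl, IsBeyond.trans hT hvu huw hwv hl'⟩
  exact main _ v u hvu rfl

end Trees

/-! ### Accessibility across tree-edges. -/

namespace GraphLabelledTree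

variable {N : Type*} (D : GraphLabelledTree N)

/-- Consecutive triples of the list correspond to adjacent marker vertices. -/
def IsCompatible (s : List N) : Prop :=
  ∀ (a v b : N) (ha : D.tree.Adj v a) (hb : D.tree.Adj v b),
    [a, v, b] <:+: s → (D.label v).Adj ⟨a, ha⟩ ⟨b, hb⟩

variable {D}

theorem isCompatible_cons {a b c : N} {s : List N} : D.IsCompatible (a :: b :: c :: s) ↔
    (∀ (ha : D.tree.Adj b a) (hc : D.tree.Adj b c), (D.label b).Adj ⟨a, ha⟩ ⟨c, hc⟩) ∧
      D.IsCompatible (b :: c :: s) := by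
  constructor
  · intro h
    refine ⟨fun ha hc => h a b c ha hc ⟨[], s, rfl⟩, fun x y z hx hz hi => h x y z hx hz ?_⟩
    exact List.infix_cons_iff.2 (Or.inr hi)
  · rintro ⟨h1, h2⟩ x y z hx hz hi
    rw [List.infix_cons_iff] at hi
    rcases hi with hi | hi
    · simp only [List.cons_prefix_cons, List.nil_prefix, and_true] at hi
      obtain ⟨rfl, rfl, rfl⟩ := hi
      exact h1 hx hz
    · exact h2 x y z hx hz hi

theorem isCompatible_of_length {s : List N} (h : s.length ≤ 2) : D.IsCompatible s := by
  intro a v b ha hb hi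
  have := hi.length_le
  simp only [List.length_cons, List.length_nil] at this
  omega

theorem IsCompatible.reverse {s : List N} (h : D.IsCompatible s) : D.IsCompatible s.reverse := by
  intro a v b ha hb hi
  refine (h b v a hb ha ?_).symm
  have := List.reverse_infix.2 hi
  simpa using this

theorem isCompatible_reverse {s : List N} : D.IsCompatible s.reverse ↔ D.IsCompatible s :=
  ⟨fun h => by simpa using h.reverse, fun h => h.reverse⟩

/-- The two pieces overlap in two entries, so each consecutive triple lies entirely in one of them.
-/
theorem isCompatible_append {u v : N} {t : List N} : ∀ s : List N,
    D.IsCompatible (s ++ u :: v :: t) ↔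
      D.IsCompatible (s ++ [u, v]) ∧ D.IsCompatible (u :: v :: t)
  | [] => by simp [isCompatible_of_length]
  | [a] => by
    simp [isCompatible_cons, isCompatible_of_length]
  | [a, b] => by
    have := isCompatible_append (u := u) (v := v) (t := t) [b]
    simp only [List.cons_append, List.nil_append, isCompatible_cons (a := a)] at this ⊢
    rw [this, and_assoc]
  | a :: b :: c :: s => by
    have := isCompatible_append (u := u) (v := v) (t := t) (b :: c :: s)
    simp only [List.cons_append, isCompatible_cons (a := a)] at this ⊢
    rw [this, and_assoc]

theorem accessible_iff {l u : N} {p : D.tree.Walk l u} (hp : p.IsPath) :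
    D.Accessible l u ↔ D.IsCompatible p.support := by
  constructor
  · rintro ⟨q, hq, h⟩
    rwa [D.isTree.isAcyclic.eq_of_isPath hp hq]
  · exact fun h => ⟨p, hp, h⟩

variable (D)

/-- `l` lies beyond the tree-edge `vu` and is accessible from its extremity at `v`. -/
def IsAccessibleFrom (v u l : N) : Prop :=
  ∃ p : D.tree.Walk u l, p.IsPath ∧ v ∉ p.support ∧ D.IsCompatible (v :: p.support)

variable {D}

theorem IsAccessibleFrom.isBeyond {v u l : N} (h : D.IsAccessibleFrom v u l) :
    IsBeyond D.tree v u l := h.imp fun _ hp => ⟨hp.1, hp.2.1⟩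

theorem isAccessibleFrom_iff {v u l : N} {p : D.tree.Walk u l} (hp : p.IsPath)
    (hv : v ∉ p.support) : D.IsAccessibleFrom v u l ↔ D.IsCompatible (v :: p.support) := by
  constructor
  · rintro ⟨q, hq, -, h⟩
    rwa [D.isTree.isAcyclic.eq_of_isPath hp hq]
  · exact fun h => ⟨p, hp, hv, h⟩

theorem isAccessibleFrom_cons {v u w l : N} (huv : D.tree.Adj u v) (huw : D.tree.Adj u w)
    (hwv : w ≠ v) (h : IsBeyond D.tree u w l) : D.IsAccessibleFrom v u l ↔
      (D.label u).Adj ⟨v, huv⟩ ⟨w, huw⟩ ∧ D.IsAccessibleFrom u w l := by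
  obtain ⟨p, hp, hu⟩ := h
  have hv := IsBeyond.not_mem_support D.isTree.isAcyclic huv.symm huw hwv hp hu
  rw [isAccessibleFrom_iff hp hu, isAccessibleFrom_iff (p := .cons huw p) (hp.cons hu)
    (by simp [huv.ne.symm, hv]), Walk.support_cons, ← p.cons_tail_support, isCompatible_cons]
  exact ⟨fun h => ⟨h.1 huv huw, h.2⟩, fun h => ⟨fun _ _ => h.1, h.2⟩⟩

theorem accessible_iff_of_isBeyond {v u l m : N} (hvu : D.tree.Adj v u)
    (hl : IsBeyond D.tree v u l) (hm : IsBeyond D.tree u v m) :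
    D.Accessible l m ↔ D.IsAccessibleFrom v u l ∧ D.IsAccessibleFrom u v m := by
  have hT := D.isTree.isAcyclic
  obtain ⟨p, hp, hv⟩ := hl
  obtain ⟨q, hq, hu⟩ := hm
  have hsup : (p.reverse.append (.cons hvu.symm q)).support = p.support.reverse ++ q.support := by
    rw [Walk.support_append, Walk.support_reverse, Walk.support_cons, List.tail_cons]
  have hr : (p.reverse.append (.cons hvu.symm q)).IsPath := by
    rw [Walk.isPath_def, hsup, List.nodup_append]
    refine ⟨List.nodup_reverse.2 hp.support_nodup, hq.support_nodup, ?_⟩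
    rintro a ha b hb rfl
    exact IsBeyond.not_symm hT hvu (.of_mem_support hp hv (List.mem_reverse.1 ha))
      (.of_mem_support hq hu hb)
  rw [accessible_iff hr, hsup, isAccessibleFrom_iff hp hv, isAccessibleFrom_iff hq hu,
    ← p.cons_tail_support, ← q.cons_tail_support, List.reverse_cons, List.append_assoc,
    List.singleton_append, isCompatible_append, ← isCompatible_reverse]
  simp

variable (D)

/-- The leaves beyond the tree-edge `vu`. -/
def leafSide (v u : N) : Set {n : N // D.IsLeaf n} := {l | IsBeyond D.tree v u l}

/-- The leaves beyond the tree-edge `vu` accessible from its extremity at `v`. -/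
def accessibleSide (v u : N) : Set {n : N // D.IsLeaf n} := {l | D.IsAccessibleFrom v u l}

variable {D}

theorem accessibleSide_subset {v u : N} : D.accessibleSide v u ⊆ D.leafSide v u :=
  fun _ h => h.isBeyond

theorem leafSide_nonempty [Finite N] {v u : N} (hvu : D.tree.Adj v u) :
    (D.leafSide v u).Nonempty := by
  obtain ⟨l, hl, hb⟩ := exists_leaf_isBeyond D.isTree.isAcyclic hvu
  exact ⟨⟨l, hl⟩, hb⟩

theorem eq_of_mem_leafSide {v u u' : N} (hu : D.tree.Adj v u) (hu' : D.tree.Adj v u')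
    {x : {n : N // D.IsLeaf n}} (h : x ∈ D.leafSide v u) (h' : x ∈ D.leafSide v u') : u = u' :=
  IsBeyond.eq D.isTree.isAcyclic hu hu' h h'

theorem leafSide_subset {v u w : N} (hvu : D.tree.Adj v u) (huw : D.tree.Adj u w) (hwv : w ≠ v) :
    D.leafSide u w ⊆ D.leafSide v u :=
  fun _ h => IsBeyond.trans D.isTree.isAcyclic hvu huw hwv h

/-- Every tree-edge separates the leaves in split fashion, because accessibility factors through the
edge. -/
theorem adj_iff_of_leafSide {v u : N} (hvu : D.tree.Adj v u) {x y : {n : N // D.IsLeaf n}}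
    (hx : x ∈ D.leafSide v u) (hy : y ∉ D.leafSide v u) :
    D.accessibilityGraph.Adj x y ↔ x ∈ D.accessibleSide v u ∧ y ∈ D.accessibleSide u v := by
  have hne : x ≠ y := by rintro rfl; exact hy hx
  change (x ≠ y ∧ D.Accessible x y) ↔ _
  rw [accessible_iff_of_isBeyond hvu hx (isBeyond_of_not D.isTree hvu hy)]
  exact ⟨fun h => h.2, fun h => ⟨hne, h⟩⟩

theorem adj_iff_of_leafSide_leafSide {v u w : N} (hu : D.tree.Adj v u) (hw : D.tree.Adj v w)
    (huw : u ≠ w) {x y : {n : N // D.IsLeaf n}} (hx : x ∈ D.leafSide v u)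
    (hy : y ∈ D.leafSide v w) : D.accessibilityGraph.Adj x y ↔
      x ∈ D.accessibleSide v u ∧ y ∈ D.accessibleSide v w ∧
        (D.label v).Adj ⟨u, hu⟩ ⟨w, hw⟩ := by
  rw [adj_iff_of_leafSide hu hx fun h => huw (eq_of_mem_leafSide hu hw h hy)]
  have : y ∈ D.accessibleSide u v ↔ _ := isAccessibleFrom_cons hu hw huw.symm hy
  rw [this, and_comm (a := (D.label v).Adj _ _)]
  rfl

end GraphLabelledTree

/-! ### Graphs prime for modules and graphs prime for splits. -/

section ModularPrime

variable {V W : Type*} {G : SimpleGraph V} {H : SimpleGraph W}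

theorem IsModularPrime.of_iso (hG : IsModularPrime G) (e : G ≃g H) : IsModularPrime H := by
  intro M hM
  have hM' : IsGraphModule G (e ⁻¹' M) := by
    intro v hv
    refine (hM (e v) hv).imp (fun h m hm => ?_) (fun h m hm => ?_)
    · exact e.map_adj_iff.1 (h _ hm)
    · exact fun h' => h _ hm (e.map_adj_iff.2 h')
  rcases hG _ hM' with h | h
  · left
    intro a ha b hb
    have := @h (e.symm a) (by simpa using ha) (e.symm b) (by simpa using hb)
    exact e.symm.injective this
  · right
    refine Set.eq_univ_of_forall fun w => ?_
    have : e.symm w ∈ e ⁻¹' M := h ▸ Set.mem_univ _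
    simpa using this

/-- Components are modules. If none is everything, all are singletons, the graph is edgeless, and
the pair `a`, `b` is a module missing `c`. -/
theorem IsModularPrime.preconnected (hG : IsModularPrime G) {a b c : V} (hab : a ≠ b)
    (hac : a ≠ c) (hbc : b ≠ c) : G.Preconnected := by
  have hcomp : ∀ v, IsGraphModule G {w | G.Reachable v w} := fun v u hu =>
    Or.inr fun w hw h => hu (Reachable.trans hw h.symm.reachable)
  by_cases h : ∃ v, {w | G.Reachable v w} = Set.univ
  · obtain ⟨v, hv⟩ := h
    intro x y
    have hx : x ∈ {w | G.Reachable v w} := hv ▸ Set.mem_univ x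
    have hy : y ∈ {w | G.Reachable v w} := hv ▸ Set.mem_univ y
    exact Reachable.trans (Reachable.symm hx) hy
  · push Not at h
    have hno : ∀ x y, ¬ G.Adj x y := fun x y hxy =>
      hxy.ne ((hG _ (hcomp x)).resolve_right (h x) (Reachable.refl x) hxy.reachable)
    rcases hG {a, b} (fun v _ => Or.inr fun m _ => hno v m) with h' | h'
    · exact absurd (h' (by simp) (by simp)) hab
    · have : c ∈ ({a, b} : Set V) := h' ▸ Set.mem_univ c
      rcases this with rfl | rfl
      · exact absurd rfl hac
      · exact absurd rfl hbc

theorem isStarWithCentre_of_forall_eq {a b c : V} (ha : G.Adj a c) (hb : G.Adj b c)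
    (hab : ¬ G.Adj a b) (hne : a ≠ b) (h : ∀ x, x = a ∨ x = b ∨ x = c) :
    IsStarWithCentre G c := by
  have hba : ¬ G.Adj b a := fun h => hab h.symm
  intro x y
  rcases h x with rfl | rfl | rfl <;> rcases h y with rfl | rfl | rfl <;>
    simp [ha, hb, ha.symm, hb.symm, hab, hba, hne, hne.symm, ha.ne, hb.ne, ha.ne.symm, hb.ne.symm]

/-- Expresses that deleting `k` leaves the graph connected: a closed set `C` with two elements would
be one side of a split whose crossing edges all end in `k`. -/
theorem IsSplitPrime.exists_adj_of_closed (hG : IsSplitPrime G) {k i j : V} (hki : k ≠ i)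
    (hkj : k ≠ j) (hij : i ≠ j) (hstar : ¬ IsStarWithCentre G k) {C : Set V} (hi : i ∈ C)
    (hj : j ∉ C) (hk : k ∉ C) : ∃ w ∈ C, ∃ w', w' ≠ k ∧ w' ∉ C ∧ G.Adj w w' := by
  by_contra! hcl
  have hcl' : ∀ a ∈ C, ∀ b ∉ C, G.Adj a b → b = k := fun a ha b hb hab => by
    by_contra hbk
    exact hcl a ha b hbk hb hab
  by_cases hC : C.Nontrivial
  · refine hG.2 C ⟨hC, ⟨k, hk, j, hj, hkj⟩, {a ∈ C | G.Adj a k}, {k}, fun a ha => ha.1, ?_, ?_⟩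
    · rintro _ rfl
      exact hk
    · intro a ha b hb
      constructor
      · intro hab
        obtain rfl := hcl' a ha b hb hab
        exact ⟨⟨ha, hab⟩, rfl⟩
      · rintro ⟨⟨-, h⟩, rfl⟩
        exact h
  · rw [Set.not_nontrivial_iff] at hC
    have hCi : ∀ x ∈ C, x = i := fun x hx => hC hx hi
    have hi' : ∀ b, G.Adj i b → b = k := fun b hib =>
      hcl' i hi b (fun hb => hib.ne (hCi b hb).symm) hib
    -- Now `i` is pendant at `k`. A fourth vertex makes the pair `i`, `k` one side of a split;
    -- without one the graph is a three-vertex path centred at `k`.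
    by_cases h4 : ∃ w, w ≠ i ∧ w ≠ j ∧ w ≠ k
    · obtain ⟨w, hwi, hwj, hwk⟩ := h4
      refine hG.2 {i, k} ⟨⟨i, by simp, k, by simp, hki.symm⟩,
        ⟨j, by simp [hij.symm, hkj.symm], w, by simp [hwi, hwk], hwj.symm⟩, {k},
        {b | b ≠ i ∧ b ≠ k ∧ G.Adj k b}, by simp, ?_, ?_⟩
      · rintro b ⟨h1, h2, -⟩
        simp [h1, h2]
      · rintro a ha b hb
        simp only [Set.mem_compl_iff, Set.mem_insert_iff, Set.mem_singleton_iff, not_or] at ha hb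
        rcases ha with rfl | rfl
        · constructor
          · intro h
            exact absurd (hi' b h) hb.2
          · rintro ⟨h, -⟩
            exact absurd h.symm hki
        · exact ⟨fun h => ⟨rfl, hb.1, hb.2, h⟩, fun h => h.2.2.2⟩
    · push Not at h4
      have nbr : ∀ x y : V, x ≠ y → ∃ z, G.Adj x z := by
        intro x y hxy
        obtain ⟨c, rfl, d, -, -, h⟩ := (hG.1.preconnected x y).exists_exit (S := {x}) rfl
          (fun h => hxy h.symm)
        exact ⟨d, h⟩
      obtain ⟨z, hz⟩ := nbr i j hij
      obtain rfl := hi' z hz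
      obtain ⟨z', hz'⟩ := nbr j i hij.symm
      have hz'i : z' ≠ i := by
        rintro rfl
        exact hkj (hi' j hz'.symm).symm
      obtain rfl := h4 z' hz'i hz'.ne.symm
      have hij' : ¬ G.Adj i j := fun h => hkj (hi' j h).symm
      have all : ∀ x, x = i ∨ x = j ∨ x = z' := fun x => by
        by_contra! hcon
        exact hcon.2.2 (h4 x hcon.1 hcon.2.1)
      exact hstar (isStarWithCentre_of_forall_eq hz hz' hij' hij all)

end ModularPrime

/-! ### Asteroidal triples from a node with three non-leaf neighbours. -/

namespace GraphLabelledTree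

variable {N : Type*} {D : GraphLabelledTree N}

theorem exists_mem_accessibleSide (hconn : D.accessibilityGraph.Preconnected) {v w : N}
    (hw : D.tree.Adj v w) {x y : {n : N // D.IsLeaf n}} (hy : y ∈ D.leafSide v w)
    (hx : x ∉ D.leafSide v w) : ∃ a ∈ D.accessibleSide v w,
      (edgesWithin D.accessibilityGraph (D.leafSide v w)).Reachable y a := by
  obtain ⟨c, hc, d, hd, hr, had⟩ := (hconn y x).exists_exit hy hx
  rw [adj_iff_of_leafSide hw hc hd] at had
  exact ⟨c, had.1, hr⟩

theorem mem_farFrom_of_not_mem_leafSide {v k : N} (hk : D.tree.Adj v k)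
    {x t : {n : N // D.IsLeaf n}} (hx : x ∈ D.leafSide v k) (hxa : x ∉ D.accessibleSide v k)
    (ht : t ∉ D.leafSide v k) : t ∈ farFrom D.accessibilityGraph x := by
  refine ⟨?_, fun h => ?_⟩
  · rintro rfl
    exact ht hx
  · rw [adj_iff_of_leafSide hk hx ht] at h
    exact hxa h.1

/-- Since `x` is not accessible from `v`, all its neighbours lie in the branch of `k`. Inside the
other branches one reaches accessible leaves, and these are linked as the label of `v` without `k`
is connected. The exception, a star centred at `k`, is bridged by an accessible leaf of the branch
of `k` not adjacent to `x`. -/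
theorem hasPathMissing_of_leafSide [Finite N] (hconn : D.accessibilityGraph.Preconnected)
    (hred : D.IsReduced) {v k i j : N} (hk : D.tree.Adj v k) (hi : D.tree.Adj v i)
    (hj : D.tree.Adj v j) (hki : k ≠ i) (hkj : k ≠ j) (hij : i ≠ j)
    {x xi xj : {n : N // D.IsLeaf n}} (hx : x ∈ D.leafSide v k) (hxa : x ∉ D.accessibleSide v k)
    (hstar : IsStarWithCentre (D.label v) ⟨k, hk⟩ →
      ∃ a ∈ D.accessibleSide v k, ¬ D.accessibilityGraph.Adj x a)
    (hxi : xi ∈ D.leafSide v i) (hxj : xj ∈ D.leafSide v j) :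
    HasPathMissing D.accessibilityGraph xi xj x := by
  have sub_ne : ∀ {w w'} {hw : D.tree.Adj v w} {hw' : D.tree.Adj v w'}, w ≠ w' →
      (⟨w, hw⟩ : D.tree.neighborSet v) ≠ ⟨w', hw'⟩ := fun h h' => h (congrArg Subtype.val h')
  have far : ∀ w, D.tree.Adj v w → w ≠ k → ∀ y ∈ D.leafSide v w,
      y ∈ farFrom D.accessibilityGraph x := fun w hw hwk y hy =>
    mem_farFrom_of_not_mem_leafSide hk hx hxa fun h => hwk (eq_of_mem_leafSide hw hk hy h)
  have inside : ∀ w, D.tree.Adj v w → w ≠ k → ∀ y ∈ D.leafSide v w,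
      ∃ a ∈ D.accessibleSide v w, HasPathMissing D.accessibilityGraph y a x := by
    intro w hw hwk y hy
    obtain ⟨a, ha, hr⟩ := exists_mem_accessibleSide hconn hw hy
      (fun h => hwk (eq_of_mem_leafSide hw hk h hx))
    exact ⟨a, ha, hasPathMissing_iff.2 ⟨far w hw hwk y hy,
      hr.mono (edgesWithin_mono (far w hw hwk))⟩⟩
  have nonempty : ∀ w, D.tree.Adj v w → w ≠ k → ∃ a, a ∈ D.accessibleSide v w := by
    intro w hw hwk
    obtain ⟨y, hy⟩ := leafSide_nonempty hw
    obtain ⟨a, ha, -⟩ := inside w hw hwk y hy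
    exact ⟨a, ha⟩
  have link : ∀ w w' (hw : D.tree.Adj v w) (hw' : D.tree.Adj v w'), w ≠ k → w' ≠ k →
      (D.label v).Adj ⟨w, hw⟩ ⟨w', hw'⟩ → ∀ a ∈ D.accessibleSide v w,
      ∀ a' ∈ D.accessibleSide v w', HasPathMissing D.accessibilityGraph a a' x := by
    intro w w' hw hw' hwk hwk' hadj a ha a' ha'
    have hne : w ≠ w' := fun h => hadj.ne (Subtype.ext h)
    have ha1 := accessibleSide_subset ha
    have ha1' := accessibleSide_subset ha'
    exact .of_adj (far w hw hwk a ha1) (far w' hw' hwk' a' ha1')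
      ((adj_iff_of_leafSide_leafSide hw hw' hne ha1 ha1').2 ⟨ha, ha', hadj⟩)
  obtain ⟨ai, hai, hpi⟩ := inside i hi hki.symm xi hxi
  obtain ⟨aj, haj, hpj⟩ := inside j hj hkj.symm xj hxj
  refine hpi.trans (HasPathMissing.trans ?_ hpj.symm)
  by_cases hadj : (D.label v).Adj ⟨i, hi⟩ ⟨j, hj⟩
  · exact link i j hi hj hki.symm hkj.symm hadj ai hai aj haj
  by_cases hs : IsStarWithCentre (D.label v) ⟨k, hk⟩
  · obtain ⟨a, ha, hxa'⟩ := hstar hs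
    have ha1 := accessibleSide_subset ha
    have hai1 := accessibleSide_subset hai
    have haj1 := accessibleSide_subset haj
    have hfar : a ∈ farFrom D.accessibilityGraph x := by
      refine ⟨?_, hxa'⟩
      rintro rfl
      exact hxa ha
    have e1 : D.accessibilityGraph.Adj ai a :=
      (adj_iff_of_leafSide_leafSide hi hk hki.symm hai1 ha1).2
        ⟨hai, ha, (hs _ _).2 ⟨sub_ne hki.symm, Or.inr rfl⟩⟩
    have e2 : D.accessibilityGraph.Adj a aj :=
      (adj_iff_of_leafSide_leafSide hk hj hkj ha1 haj1).2
        ⟨ha, haj, (hs _ _).2 ⟨sub_ne hkj, Or.inl rfl⟩⟩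
    exact (HasPathMissing.of_adj (far i hi hki.symm ai hai1) hfar e1).trans
      (.of_adj hfar (far j hj hkj.symm aj haj1) e2)
  have hv : ¬ D.IsLeaf v := fun h => hij (h hi hj)
  rcases hred.2.1 v hv with hc | ⟨⟨c, hc⟩, hcs⟩ | hp
  · exact absurd (hc ⟨i, hi⟩ ⟨j, hj⟩ (sub_ne hij)) hadj
  · have hck : c ≠ k := by rintro rfl; exact hs hcs
    have hci : c ≠ i := by
      rintro rfl
      exact hadj ((hcs _ _).2 ⟨sub_ne hij, Or.inl rfl⟩)
    have hcj : c ≠ j := by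
      rintro rfl
      exact hadj ((hcs _ _).2 ⟨sub_ne hij, Or.inr rfl⟩)
    obtain ⟨a, ha⟩ := nonempty c hc hck
    exact (link i c hi hc hki.symm hck ((hcs _ _).2 ⟨sub_ne hci.symm, Or.inr rfl⟩)
      ai hai a ha).trans (link c j hc hj hck hkj.symm
        ((hcs _ _).2 ⟨sub_ne hcj, Or.inl rfl⟩) a ha aj haj)
  · let C : Set (D.tree.neighborSet v) := {w | w.1 ≠ k ∧ (w.1 = i ∨
      ∀ a ∈ D.accessibleSide v w, HasPathMissing D.accessibilityGraph ai a x)}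
    by_contra hcon
    obtain ⟨⟨w, hw⟩, hwC, ⟨w', hw'⟩, hwk', hwC', hww'⟩ := hp.exists_adj_of_closed
      (k := ⟨k, hk⟩) (i := ⟨i, hi⟩) (j := ⟨j, hj⟩) (C := C) (sub_ne hki)
      (sub_ne hkj) (sub_ne hij) hs ⟨hki.symm, Or.inl rfl⟩
      (fun h => h.2.elim (fun h => hij h.symm) fun h => hcon (h aj haj)) (fun h => h.1 rfl)
    have hwk'' : w' ≠ k := fun h => hwk' (Subtype.ext h)
    refine hwC' ⟨hwk'', Or.inr fun a' ha' => ?_⟩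
    obtain ⟨hwk, hwi⟩ := hwC
    simp only at hwk hwi
    by_cases h : w = i
    · subst h
      exact link w w' hw hw' hwk hwk'' hww' ai hai a' ha'
    · obtain ⟨a, ha⟩ := nonempty w hw hwk
      exact (hwi.resolve_left h a ha).trans (link w w' hw hw' hwk hwk'' hww' a ha a' ha')

/-- If all leaves beyond `vk` were accessible they would form a nontrivial proper module. In the
star case, failure makes the accessible and the inaccessible leaves beyond `vk` completely joined,
and each of the two sets a module. -/
theorem exists_mem_leafSide_diff [Finite N] (hprime : IsModularPrime D.accessibilityGraph)
    (hred : D.IsReduced) {v k j : N} (hk : D.tree.Adj v k) (hj : D.tree.Adj v j) (hkj : k ≠ j)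
    (hkl : ¬ D.IsLeaf k) : ∃ x ∈ D.leafSide v k, x ∉ D.accessibleSide v k ∧
      (IsStarWithCentre (D.label v) ⟨k, hk⟩ →
        ∃ a ∈ D.accessibleSide v k, ¬ D.accessibilityGraph.Adj x a) := by
  have hv : ¬ D.IsLeaf v := fun h => hkj (h hk hj)
  obtain ⟨y, hy⟩ := leafSide_nonempty hj
  have hyk : y ∉ D.leafSide v k := fun h => hkj (eq_of_mem_leafSide hk hj h hy)
  have hcard : 1 < (D.tree.neighborSet k \ {v}).ncard := by
    have h1 := hred.1 k hkl
    have h2 := Set.ncard_sdiff_singleton_add_one (s := D.tree.neighborSet k) (a := v) hk.symm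
      (Set.toFinite _)
    omega
  obtain ⟨w₁, ⟨hw₁, hw₁v⟩, w₂, ⟨hw₂, hw₂v⟩, hw⟩ := (Set.one_lt_ncard (Set.toFinite _)).1 hcard
  obtain ⟨l₁, hl₁⟩ := leafSide_nonempty hw₁
  obtain ⟨l₂, hl₂⟩ := leafSide_nonempty hw₂
  have hl : l₁ ≠ l₂ := by
    rintro rfl
    exact hw (eq_of_mem_leafSide hw₁ hw₂ hl₁ hl₂)
  have sub : ∀ {w}, D.tree.Adj k w → w ≠ v → D.leafSide k w ⊆ D.leafSide v k :=
    fun hw hwv => leafSide_subset hk hw hwv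
  have hl₁k := sub hw₁ hw₁v hl₁
  have hl₂k := sub hw₂ hw₂v hl₂
  have outside : ∀ t ∉ D.leafSide v k,
      (∀ m ∈ D.accessibleSide v k, D.accessibilityGraph.Adj t m) ∨
        (∀ m ∈ D.leafSide v k, ¬ D.accessibilityGraph.Adj t m) := by
    intro t ht
    by_cases hta : t ∈ D.accessibleSide k v
    · left
      intro m hm
      exact ((adj_iff_of_leafSide hk (accessibleSide_subset hm) ht).2 ⟨hm, hta⟩).symm
    · right
      intro m hm h
      exact hta ((adj_iff_of_leafSide hk hm ht).1 h.symm).2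
  by_cases hs : IsStarWithCentre (D.label v) ⟨k, hk⟩
  swap
  · by_contra! hcon
    have hall : ∀ x ∈ D.leafSide v k, x ∈ D.accessibleSide v k := by
      intro x hx
      by_contra hxa
      exact hs (hcon x hx hxa).1
    rcases hprime (D.leafSide v k) (fun t ht => (outside t ht).imp
      (fun h m hm => h m (hall m hm)) id) with h | h
    · exact hl (h hl₁k hl₂k)
    · exact hyk (h ▸ Set.mem_univ y)
  by_contra! hcon
  have hcompl : ∀ x ∈ D.leafSide v k, x ∉ D.accessibleSide v k → ∀ a ∈ D.accessibleSide v k,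
      D.accessibilityGraph.Adj x a := fun x hx hxa => (hcon x hx hxa).2
  have hA : (D.accessibleSide v k).Subsingleton := by
    refine (hprime _ fun t ht => ?_).resolve_right
      fun h => hyk (accessibleSide_subset (h ▸ Set.mem_univ y))
    by_cases htk : t ∈ D.leafSide v k
    · exact Or.inl (hcompl t htk ht)
    · exact (outside t htk).imp id fun h m hm => h m (accessibleSide_subset hm)
  have hB : (D.leafSide v k \ D.accessibleSide v k).Subsingleton := by
    refine (hprime _ fun t ht => ?_).resolve_right fun h => ?_
    rotate_left
    · have : y ∈ D.leafSide v k \ D.accessibleSide v k := h ▸ Set.mem_univ y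
      exact hyk this.1
    by_cases htk : t ∈ D.leafSide v k
    · have hta : t ∈ D.accessibleSide v k := by
        by_contra hta
        exact ht ⟨htk, hta⟩
      exact Or.inl fun m hm => (hcompl m hm.1 hm.2 t hta).symm
    · right
      intro m hm h
      exact hm.2 ((adj_iff_of_leafSide hk hm.1 htk).1 h.symm).1
  -- Only one accessible leaf `l₁` and one inaccessible leaf `l₂` remain, so `k` has just the
  -- neighbours `v`, `w₁`, `w₂`. Its label is a star centred at `w₁`, and the edge `vk` joins a
  -- centre to a non-central vertex, against reducedness.
  have fin : ∀ {w₁ w₂ l₁ l₂}, ∀ hw₁ : D.tree.Adj k w₁, w₁ ≠ v → ∀ hw₂ : D.tree.Adj k w₂,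
      w₂ ≠ v → w₁ ≠ w₂ → l₁ ∈ D.leafSide k w₁ → l₂ ∈ D.leafSide k w₂ →
      l₁ ∈ D.accessibleSide v k → l₂ ∉ D.accessibleSide v k → False := by
    intro w₁ w₂ l₁ l₂ hw₁ hw₁v hw₂ hw₂v hw hl₁ hl₂ hl₁a hl₂a
    have all : ∀ w : D.tree.neighborSet k, w = ⟨v, hk.symm⟩ ∨ w = ⟨w₁, hw₁⟩ ∨ w = ⟨w₂, hw₂⟩ := by
      rintro ⟨w, hkw⟩
      by_cases hwv : w = v
      · exact Or.inl (Subtype.ext hwv)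
      obtain ⟨l, hl⟩ := leafSide_nonempty hkw
      have hlk := sub hkw hwv hl
      right
      by_cases hla : l ∈ D.accessibleSide v k
      · left
        obtain rfl := hA hla hl₁a
        exact Subtype.ext (eq_of_mem_leafSide hkw hw₁ hl hl₁)
      · right
        obtain rfl := hB ⟨hlk, hla⟩ ⟨sub hw₂ hw₂v hl₂, hl₂a⟩
        exact Subtype.ext (eq_of_mem_leafSide hkw hw₂ hl hl₂)
    have e := hcompl l₂ (sub hw₂ hw₂v hl₂) hl₂a l₁ hl₁a
    rw [adj_iff_of_leafSide_leafSide hw₂ hw₁ hw.symm hl₂ hl₁] at e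
    obtain ⟨e1, -, e2⟩ := e
    have e3 := ((isAccessibleFrom_cons hk.symm hw₁ hw₁v hl₁).1 hl₁a).1
    have e4 : ¬ (D.label k).Adj ⟨v, hk.symm⟩ ⟨w₂, hw₂⟩ := fun h =>
      hl₂a ((isAccessibleFrom_cons hk.symm hw₂ hw₂v hl₂).2 ⟨h, e1⟩)
    have hstar : IsStarWithCentre (D.label k) ⟨w₁, hw₁⟩ :=
      isStarWithCentre_of_forall_eq e3 e2 e4 (fun h => hw₂v (congrArg Subtype.val h).symm)
        fun w => (all w).imp id Or.symm
    have := hred.2.2.2 v k hk hv hkl _ hs hstar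
    exact hw₁v (congrArg Subtype.val this)
  by_cases h₁ : l₁ ∈ D.accessibleSide v k
  · exact fin hw₁ hw₁v hw₂ hw₂v hw hl₁ hl₂ h₁ fun h₂ => hl (hA h₁ h₂)
  · refine fin hw₂ hw₂v hw₁ hw₁v hw.symm hl₂ hl₁ ?_ h₁
    by_contra h₂
    exact hl (hB ⟨hl₁k, h₁⟩ ⟨hl₂k, h₂⟩)

theorem isCaterpillar_of_isModularPrime [Finite N]
    (hprime : IsModularPrime D.accessibilityGraph) (hAT : IsATFree D.accessibilityGraph)
    (hred : D.IsReduced) : IsCaterpillar D.tree := by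
  refine D.isTree.isCaterpillar fun v u₁ u₂ u₃ h₁ h₂ h₃ h₁₂ h₁₃ h₂₃ hl₁ hl₂ => ?_
  by_contra hl₃
  obtain ⟨x₁, hx₁, hxa₁, hs₁⟩ := exists_mem_leafSide_diff hprime hred h₁ h₂ h₁₂ hl₁
  obtain ⟨x₂, hx₂, hxa₂, hs₂⟩ := exists_mem_leafSide_diff hprime hred h₂ h₃ h₂₃ hl₂
  obtain ⟨x₃, hx₃, hxa₃, hs₃⟩ := exists_mem_leafSide_diff hprime hred h₃ h₁ h₁₃.symm hl₃
  have ne : ∀ {u u' x x'}, D.tree.Adj v u → D.tree.Adj v u' → u ≠ u' → x ∈ D.leafSide v u →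
      x' ∈ D.leafSide v u' → x ≠ x' := by
    rintro u u' x x' hu hu' hne hx hx' rfl
    exact hne (eq_of_mem_leafSide hu hu' hx hx')
  have hconn := hprime.preconnected (ne h₁ h₂ h₁₂ hx₁ hx₂) (ne h₁ h₃ h₁₃ hx₁ hx₃)
    (ne h₂ h₃ h₂₃ hx₂ hx₃)
  exact hAT x₁ x₂ x₃ (.of_paths
    (hasPathMissing_of_leafSide hconn hred h₃ h₁ h₂ h₁₃.symm h₂₃.symm h₁₂ hx₃ hxa₃ hs₃ hx₁ hx₂)
    (hasPathMissing_of_leafSide hconn hred h₁ h₂ h₃ h₁₂ h₁₃ h₂₃ hx₁ hxa₁ hs₁ hx₂ hx₃)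
    (hasPathMissing_of_leafSide hconn hred h₂ h₁ h₃ h₁₂.symm h₂₃ h₁₃ hx₂ hxa₂ hs₂ hx₁ hx₃))

end GraphLabelledTree

theorem mainTheorem10 {V : Type*} [Finite V] (G : SimpleGraph V) :
    (IsModularPrime G → IsATFree G →
      ∀ {N : Type*} [Finite N] (D : GraphLabelledTree N),
        D.IsCanonicalSplitDecomposition G → IsCaterpillar D.tree) ∧
    (IsDHATFree G ↔ ∀ S : Set V, ¬ IsListedObstruction (G.induce S)) ∧
    ((¬ IsDHATFree G ∧ ∀ S : Set V, S ≠ Set.univ → IsDHATFree (G.induce S)) ↔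
      IsListedObstruction G) := by
  refine ⟨fun hprime hAT N _ D hD => ?_, isDHATFree_iff_isObstructionFree,
    minimal_not_isDHATFree_iff⟩
  obtain ⟨hred, ⟨e⟩⟩ := hD
  exact GraphLabelledTree.isCaterpillar_of_isModularPrime (hprime.of_iso e)
    (hAT.of_embedding e.symm.toEmbedding) hred
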